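/- Notation. Let $\mathbb{T}=\mathbb{R}/2\pi\mathbb{Z}$ with distance $|u-v|=\min_{n\in\mathbb{Z}}|u-v+2\pi n|$. For an integer $m\ge 1$ let $I(m)=\{-\frac{m-1}{2},-\frac{m-1}{2}+1,\dots,\frac{m-1}{2}\}$ and $\phi(t)=\frac{1}{\sqrt m}[e^{ikt}]_{k\in I(m)}\in\mathbb{C}^m$. For $x=\{x_j\}_{j=1}^s\subset\mathbb{T}$ let $\Delta(x)=\min_{j\ne k}|x_j-x_k|$ ($+\infty$ if $s\le 1$) and let $U$ be the range of the matrix $[e^{ikx_j}]_{k\in I(m),\,1\le j\le s}$. For an $s$-dimensional subspace $\tilde U\subset\mathbb{C}^m$, write $P_U,P_{\tilde U}$ for the orthogonal projections and set $\vartheta=\vartheta(x,\tilde U)=\|P_U-P_{\tilde U}\|_2$ and $\tilde q(t)=1-\|P_{\tilde U}\phi(t)\|_2^2$, a smooth function on $\mathbb{T}$. For a finite set $G\subset\mathbb{T}$ let ${\rm mesh}(G)=\max_{t\in\mathbb{T}}\min_{u\in G}|t-u|$ ($+\infty$ if $G=\emptyset$). The path in $G$ between $v,w\in G$ is $\{u\in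 G: |v-u|+|u-w|=|v-w|\}$, i.e. the elements of $G$ on the shorter arc from $v$ to $w$. A cluster in $G$ is a subset $V\subset G$ containing the path in $G$ between any two of its elements; the clusters of $A\subset G$ are the maximal nonempty clusters in $G$ contained in $A$. Gradient-MUSIC with adaptive termination (parameters $G,\alpha,h,\epsilon,N_{\min},N_{\max}$): let $A=\{u\in G:\tilde q(u)<\alpha\}$; find the $s$ clusters of $A$ and pick an arbitrary representative $t_{j,0}$ of each, $j=1,\dots,s$; iterate $t_{j,k+1}=t_{j,k}-h\,\tilde q\,'(t_{j,k})$ and stop at $$n_j=\min\{k\in\mathbb{N}: N_{\min}\le k\le N_{\max},\ |\tilde q\,'(t_{j,k})|\le \epsilon m\};$$ if this set is nonempty for every $j$, output $\hat x=\{\hat x_j\}_{j=1}^s$ with $\hat x_j=t_{j,n_j}$ (otherwise there is no output). Theorem. Let $m\ge 100$, $\alpha=0.529$, $h=6/m^2$, let $G\subset\mathbb{T}$ be finite with ${\rm mesh}(G)\le 1/(2m)$, let $\epsilon>0$ and $31\le N_{\min}\le N_{\max}$. Let $x=\{x_j\}_{j=1}^s\subset\mathbb{T}$ and let $\tilde U\subset\mathbb{C}^m$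 be a subspace of dimension $s$ such that $\Delta(x)\ge 8\pi/m$ and $\vartheta=\vartheta(x,\tilde U)\le 0.01$. Then: (i) the set $A$ has exactly $s$ clusters; (ii) for gradient descent started from any representative of any cluster of $A$, there is an iteration $k\ge N_{\min}$ with $|\tilde q\,'(t_k)|\le\epsilon m$ (so the algorithm terminates if $N_{\max}$ is large enough); (iii) for every choice of representatives for which the algorithm has an output $\hat x$, after indexing $\hat x$ to best match $x$, $$\max_{j=1,\dots,s}|x_j-\hat x_j|\le \frac{7\vartheta}{m}+\frac{37\epsilon}{m}.$$ -/

import Mathlib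

open scoped ENNReal Matrix

namespace GradMUSIC

noncomputable section

/-! ### The torus, separation, mesh norm

The torus `ℝ / 2πℤ` is `Real.Angle`. Its distance is `dist u v = min over n of |u - v + 2πn|`, and
`Real.Angle.toReal` is the representative in `(-π, π]`. -/

/-- The distance on the torus is the smallest distance between real representatives. -/
theorem isLeast_dist (u v : ℝ) :
    IsLeast {d : ℝ | ∃ n : ℤ, d = |u - v + 2 * Real.pi * n|}
      (dist (u : Real.Angle) (v : Real.Angle)) := by
  have key : dist (u : Real.Angle) (v : Real.Angle)
      = |(u - v) - round ((2 * Real.pi)⁻¹ * (u - v)) * (2 * Real.pi)| := by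
    rw [dist_eq_norm]
    exact AddCircle.norm_eq (2 * Real.pi) (x := u - v)
  constructor
  · refine ⟨-round ((2 * Real.pi)⁻¹ * (u - v)), ?_⟩
    rw [key]; congr 1; push_cast; ring
  · rintro d ⟨n, rfl⟩
    have h : dist (u : Real.Angle) (v : Real.Angle)
        = ‖(((u - v + 2 * Real.pi * n : ℝ)) : Real.Angle)‖ := by
      rw [dist_eq_norm]
      congr 1
      rw [← Real.Angle.coe_sub, Real.Angle.angle_eq_iff_two_pi_dvd_sub]
      exact ⟨-n, by push_cast; ring⟩
    rw [h]
    exact QuotientAddGroup.norm_mk_le_norm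

/-- The minimum separation `Δ(x)`, the minimum of `|x j - x k|` over `j ≠ k` (it is `⊤` if there
is at most one point). -/
def minSep {s : ℕ} (x : Fin s → Real.Angle) : ℝ≥0∞ :=
  ⨅ (j : Fin s) (k : Fin s) (_ : j ≠ k), edist (x j) (x k)

/-- The mesh norm `max_t min_{u ∈ G} |t - u|` of a finite subset of the torus (it is `⊤` for the
empty set). -/
def mesh (G : Finset Real.Angle) : ℝ≥0∞ :=
  ⨆ t : Real.Angle, Metric.infEDist t (G : Set Real.Angle)

/-! ### Steering vectors, Fourier subspaces, landscape functions -/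

/-- The `l`-th element `l - (m - 1) / 2` of the index set
`I(m) = {-(m-1)/2, -(m-1)/2 + 1, …, (m-1)/2}`. -/
def freqIndex (m : ℕ) (l : Fin m) : ℝ := (l : ℝ) - ((m : ℝ) - 1) / 2

/-- The normalized steering vector `φ(t) = m^(-1/2) [e^{ikt}]_{k ∈ I(m)}`. -/
def steering (m : ℕ) (t : ℝ) : EuclideanSpace ℂ (Fin m) :=
  WithLp.toLp 2 fun l => ((1 / Real.sqrt m : ℝ) : ℂ) *
    Complex.exp (Complex.I * (freqIndex m l : ℂ) * (t : ℂ))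

/-- The nonharmonic Fourier matrix `Φ(m, x) = [e^{ikx_j}]_{k ∈ I(m), j}`. -/
def fourierMatrix (m : ℕ) {s : ℕ} (x : Fin s → Real.Angle) : Matrix (Fin m) (Fin s) ℂ :=
  Matrix.of fun l j => Complex.exp (Complex.I * (freqIndex m l : ℂ) * ((x j).toReal : ℂ))

/-- The Fourier subspace generated by `x`: the range of the Fourier matrix. -/
def fourierSubspace (m : ℕ) {s : ℕ} (x : Fin s → Real.Angle) :
    Submodule ℂ (EuclideanSpace ℂ (Fin m)) :=
  LinearMap.range (Matrix.toEuclideanLin (fourierMatrix m x))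

/-- The sine-theta distance `‖V V* - W W*‖₂` of two subspaces. Here `V V*` is the orthogonal
projection onto `V` (see `starProjection_range`). -/
def sinTheta {m : ℕ} (V W : Submodule ℂ (EuclideanSpace ℂ (Fin m))) : ℝ :=
  ‖V.starProjection - W.starProjection‖

/-- The subspace error `ϑ(x, W)`: the sine-theta distance between the Fourier subspace generated
by `x` and `W`. -/
def subspaceError {m s : ℕ} (x : Fin s → Real.Angle)
    (W : Submodule ℂ (EuclideanSpace ℂ (Fin m))) : ℝ :=
  sinTheta (fourierSubspace m x) W

/-- The landscape function `q_W(t) = 1 - ‖W* φ(t)‖₂²` on the torus. The norm of `W* φ(t)`, for an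
orthonormal basis of the subspace, is the norm of the orthogonal projection of `φ(t)`
(see `landscape_range`), and any real representative of `t` gives the same value
(see `landscape_coe`). -/
def landscape {m : ℕ} (W : Submodule ℂ (EuclideanSpace ℂ (Fin m))) (t : Real.Angle) : ℝ :=
  1 - ‖W.starProjection (steering m t.toReal)‖ ^ 2

/-- The derivative of a function on the torus. -/
def torusDeriv (f : Real.Angle → ℝ) (t : Real.Angle) : ℝ :=
  deriv (fun r : ℝ => f (t + (r : Real.Angle))) 0

/-! ### The algorithm -/

/-- The accepted elements `A(α) = {u ∈ G : q(u) < α}`. -/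
def accepted (q : Real.Angle → ℝ) (G : Finset Real.Angle) (α : ℝ) : Set Real.Angle :=
  {u | u ∈ G ∧ q u < α}

/-- The path in `G` that connects `v` and `w`: the elements of `G` on the shorter arc between `v`
and `w`, that is, those with `|v - u| + |u - w| = |v - w|`. (If `v` and `w` are antipodal, both
arcs are shortest and both belong to the path.) -/
def path (G : Finset Real.Angle) (v w : Real.Angle) : Set Real.Angle :=
  {u | u ∈ G ∧ dist v u + dist u w = dist v w}

/-- `V ⊆ G` is a cluster in `G` if it contains the path in `G` between any two of its elements. -/
def IsCluster (G : Finset Real.Angle) (V : Set Real.Angle) : Prop :=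
  V ⊆ (G : Set Real.Angle) ∧ ∀ v ∈ V, ∀ w ∈ V, path G v w ⊆ V

/-- The clusters of a subset `A` of `G`: the maximal nonempty clusters in `G` that are contained
in `A`. -/
def clusters (G : Finset Real.Angle) (A : Set Real.Angle) : Set (Set Real.Angle) :=
  {V | Maximal (fun V' : Set Real.Angle => V'.Nonempty ∧ V' ⊆ A ∧ IsCluster G V') V}

/-- The `k`-th iterate of gradient descent `t ↦ t - h q'(t)` on the torus from `t₀`. -/
def gradIter (q : Real.Angle → ℝ) (h : ℝ) (t₀ : Real.Angle) (k : ℕ) : Real.Angle :=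
  (fun t : Real.Angle => t - ((h * torusDeriv q t : ℝ) : Real.Angle))^[k] t₀

/-- `xhat` is an output of Gradient-MUSIC with adaptive termination, run on the subspace `W` and
sparsity `s`: for some enumeration `V` of the clusters of the accepted elements and some choice of
representatives `t₀ j ∈ V j`, gradient descent from `t₀ j` is stopped at
`n j = min {k : Nmin ≤ k ≤ Nmax and |q'(t_{j,k})| ≤ ε m}`, and `xhat j = t_{j, n j}`. There is no
output if one of these sets of iterations is empty. -/
def IsOutput {m s : ℕ} (W : Submodule ℂ (EuclideanSpace ℂ (Fin m))) (G : Finset Real.Angle)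
    (α h ε : ℝ) (Nmin Nmax : ℕ) (xhat : Fin s → Real.Angle) : Prop :=
  ∃ (V : Fin s → Set Real.Angle) (t₀ : Fin s → Real.Angle) (n : Fin s → ℕ),
    Function.Injective V ∧
    Set.range V = clusters G (accepted (landscape W) G α) ∧
    (∀ j, t₀ j ∈ V j) ∧
    ∀ j, IsLeast {k : ℕ | Nmin ≤ k ∧ k ≤ Nmax ∧
          |torusDeriv (landscape W) (gradIter (landscape W) h (t₀ j) k)| ≤ ε * m} (n j) ∧
      xhat j = gradIter (landscape W) h (t₀ j) (n j)

/-! ### Consistency of the definitions -/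

theorem steering_add_two_pi (m : ℕ) (t : ℝ) (n : ℤ) :
    ∃ c : ℂ, ‖c‖ = 1 ∧ steering m (t + 2 * Real.pi * n) = c • steering m t := by
  refine ⟨Complex.exp (((-((m : ℝ) - 1) * Real.pi * n : ℝ) : ℂ) * Complex.I),
    Complex.norm_exp_ofReal_mul_I _, ?_⟩
  ext l
  simp only [steering, PiLp.smul_apply, smul_eq_mul, freqIndex]
  rw [mul_left_comm, ← Complex.exp_add]
  congr 1
  rw [Complex.exp_eq_exp_iff_exists_int]
  exact ⟨(l : ℤ) * n, by push_cast; ring⟩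

/-- The landscape function as a `2π`-periodic function of a real variable. -/
theorem landscape_coe {m : ℕ} (W : Submodule ℂ (EuclideanSpace ℂ (Fin m))) (t : ℝ) :
    landscape W (t : Real.Angle) = 1 - ‖W.starProjection (steering m t)‖ ^ 2 := by
  obtain ⟨n, hn⟩ := Real.Angle.angle_eq_iff_two_pi_dvd_sub.1
    (Real.Angle.coe_toReal (t : Real.Angle))
  have h : (t : Real.Angle).toReal = t + 2 * Real.pi * n := by linarith
  obtain ⟨c, hc, hs⟩ := steering_add_two_pi m t n
  rw [landscape, h, hs, map_smul, norm_smul, hc, one_mul]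

/-- The derivative on the torus of the landscape function is its derivative in a real variable. -/
theorem torusDeriv_landscape_coe {m : ℕ} (W : Submodule ℂ (EuclideanSpace ℂ (Fin m))) (t : ℝ) :
    torusDeriv (landscape W) (t : Real.Angle)
      = deriv (fun r : ℝ => 1 - ‖W.starProjection (steering m r)‖ ^ 2) t := by
  have h : (fun r : ℝ => landscape W ((t : Real.Angle) + (r : Real.Angle)))
      = fun r : ℝ => (fun r : ℝ => 1 - ‖W.starProjection (steering m r)‖ ^ 2) (t + r) := by
    funext r
    rw [← Real.Angle.coe_add, landscape_coe]
  rw [torusDeriv, h,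
    deriv_comp_const_add (f := fun r : ℝ => 1 - ‖W.starProjection (steering m r)‖ ^ 2), add_zero]

/-- For a matrix `W` with orthonormal columns, `W W*` is the orthogonal projection onto its
range. -/
theorem starProjection_range {m s : ℕ} (W : Matrix (Fin m) (Fin s) ℂ) (hW : Wᴴ * W = 1)
    (v : EuclideanSpace ℂ (Fin m)) :
    (LinearMap.range (Matrix.toEuclideanLin W)).starProjection v
      = Matrix.toEuclideanLin (W * Wᴴ) v := by
  have hmul : ∀ u : EuclideanSpace ℂ (Fin m),
      Matrix.toEuclideanLin (W * Wᴴ) u = Matrix.toEuclideanLin W (Matrix.toEuclideanLin Wᴴ u) := by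
    intro u; ext i; simp [Matrix.mulVec_mulVec]
  apply Submodule.eq_starProjection_of_mem_of_inner_eq_zero
  · rw [hmul]; exact ⟨_, rfl⟩
  · rintro _ ⟨z, rfl⟩
    have h1 : Matrix.toEuclideanLin Wᴴ (v - Matrix.toEuclideanLin (W * Wᴴ) v) = 0 := by
      rw [map_sub, sub_eq_zero]
      ext i
      simp [Matrix.mulVec_mulVec, ← Matrix.mul_assoc, hW]
    have h2 := Matrix.toEuclideanLin_conjTranspose_eq_adjoint W
    rw [← LinearMap.adjoint_inner_left, ← h2, h1, inner_zero_left]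

/-- The landscape function through a matrix `W` with orthonormal columns. -/
theorem landscape_range {m s : ℕ} (W : Matrix (Fin m) (Fin s) ℂ) (hW : Wᴴ * W = 1) (t : ℝ) :
    landscape (LinearMap.range (Matrix.toEuclideanLin W)) (t : Real.Angle)
      = 1 - ‖Matrix.toEuclideanLin Wᴴ (steering m t)‖ ^ 2 := by
  rw [landscape_coe, starProjection_range W hW]
  have hmul : Matrix.toEuclideanLin (W * Wᴴ) (steering m t)
      = Matrix.toEuclideanLin W (Matrix.toEuclideanLin Wᴴ (steering m t)) := by
    ext i; simp [Matrix.mulVec_mulVec]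
  rw [hmul]
  set z := Matrix.toEuclideanLin Wᴴ (steering m t)
  have h : Matrix.toEuclideanLin Wᴴ (Matrix.toEuclideanLin W z) = z := by
    ext i; simp [Matrix.mulVec_mulVec, hW]
  have h3 : ‖Matrix.toEuclideanLin W z‖ ^ 2 = ‖z‖ ^ 2 := by
    have e1 := inner_self_eq_norm_sq_to_K (𝕜 := ℂ) (Matrix.toEuclideanLin W z)
    have e2 := inner_self_eq_norm_sq_to_K (𝕜 := ℂ) z
    rw [← LinearMap.adjoint_inner_left, ← Matrix.toEuclideanLin_conjTranspose_eq_adjoint, h, e2]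
      at e1
    exact_mod_cast e1.symm
  rw [h3]

end

end GradMUSIC

open GradMUSIC

namespace GradMUSIC

/-! Let `U` be the span of the steering vectors at the points `ξ j`, real lifts of the nodes. These
vectors have real inner products, given by the Dirichlet kernel `D`, whose square decays like `(m
sin (t / 2))⁻²`. Separation by `8π / m` makes the sum of this decay over the other nodes at most `7
/ 300`, and also gives the Riesz bound `gram_lower` with constant `0.694`. Projections onto `U` are
therefore controlled by the inner products with the individual steering vectors
(`separated_projection`). The error in the subspace changes the landscape function by at most `ϑ`
and its derivative by at most `0.57736 ϑ m`, so it suffices to know the unperturbed function.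

Farther than `3.9 / m` from all nodes, the unperturbed function is at least `0.539`
(`far_landscape`), so no point there is accepted. Within `3.9 / m` of `ξ j`, split `φ` and `φ'` into
their components along `φ (ξ j)` and the orthogonal remainders. As `φ (ξ j)` lies in `U`, the
derivative is `-2 D D'` plus an inner product of projected remainders. One remainder vanishes at `ξ
j` and has the other as its derivative, so this interference is linear in the distance and is
absorbed by `-2 D D'`. The outcome is `near_perturbed`: the perturbed derivative is `ρ m² (t - ξ j)`
up to `0.57736 ϑ m`, with `ρ` between `0.0087` and `0.211`, and at least `0.086` within `1.5 / m`.

Clusters: by the sign of this derivative, the perturbed function is monotone on each side of `ξ j`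
outside a core of radius `0.7 / m`, and inside the core it is below the threshold. The accepted
points near `ξ j` thus form a cluster. The mesh condition puts a grid point in each core, and a
rejected grid point in the gap next to each node, so clusters of different nodes cannot merge
(`clusters_eq_range`).

Descent: the landscape function is nonnegative, and each step lowers it by a multiple of the squared
gradient, so every gradient tolerance is met; this needs neither separation nor a small `ϑ`. Near `ξ
j` a step contracts the distance up to an additive error, and after `31` steps the iterate is within
`1.5 / m`. There `ρ ≥ 0.086` converts a small gradient into a small distance (`gradIter_error_le`).
-/

/-! ### The Dirichlet kernel -/

/-- The normalized Dirichlet kernel `m⁻¹ ∑ cos (k t)` over `k ∈ I(m)`. -/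
noncomputable def dirichlet (m : ℕ) (t : ℝ) : ℝ := (∑ l : Fin m, Real.cos (freqIndex m l * t)) / m

/-- The derivative of the normalized Dirichlet kernel. -/
noncomputable def dirichletDeriv (m : ℕ) (t : ℝ) : ℝ :=
  -(∑ l : Fin m, freqIndex m l * Real.sin (freqIndex m l * t)) / m

theorem hasDerivAt_dirichlet (m : ℕ) (t : ℝ) :
    HasDerivAt (dirichlet m) (dirichletDeriv m t) t := by
  have h : ∀ l : Fin m, HasDerivAt (fun t : ℝ => Real.cos (freqIndex m l * t))
      (-(freqIndex m l * Real.sin (freqIndex m l * t))) t := by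
    intro l
    have := ((hasDerivAt_id t).const_mul (freqIndex m l)).cos
    simpa [mul_comm] using this
  have := (HasDerivAt.fun_sum fun (l : Fin m) (_ : l ∈ Finset.univ) => h l).div_const (m : ℝ)
  rw [Finset.sum_neg_distrib] at this
  exact this

/-- Product-to-sum makes the sum telescope. The form without division remains valid at the zeros of
the sine and can be differentiated. -/
theorem dirichlet_mul_sin {m : ℕ} (hm : m ≠ 0) (t : ℝ) :
    m * dirichlet m t * Real.sin (t / 2) = Real.sin (m * t / 2) := by
  have hm' : (m : ℝ) ≠ 0 := by exact_mod_cast hm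
  have h1 : ∀ l : ℕ, 2 * (Real.cos (((l : ℝ) - ((m : ℝ) - 1) / 2) * t) * Real.sin (t / 2))
      = Real.sin ((((l + 1 : ℕ) : ℝ) - m / 2) * t) - Real.sin (((l : ℝ) - m / 2) * t) := by
    intro l
    rw [Real.sin_sub_sin]
    push_cast
    have e1 : (((l : ℝ) + 1 - m / 2) * t - (l - m / 2) * t) / 2 = t / 2 := by ring
    have e2 : (((l : ℝ) + 1 - m / 2) * t + (l - m / 2) * t) / 2
        = ((l : ℝ) - ((m : ℝ) - 1) / 2) * t := by ring
    rw [e1, e2]; ring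
  have h2 : ∑ l ∈ Finset.range m,
      2 * (Real.cos (((l : ℝ) - ((m : ℝ) - 1) / 2) * t) * Real.sin (t / 2))
      = 2 * Real.sin (m * t / 2) := by
    rw [Finset.sum_congr rfl fun l _ => h1 l,
      Finset.sum_range_sub (fun l : ℕ => Real.sin (((l : ℝ) - m / 2) * t))]
    have e1 : ((m : ℝ) - m / 2) * t = m * t / 2 := by ring
    have e2 : (((0 : ℕ) : ℝ) - m / 2) * t = -(m * t / 2) := by push_cast; ring
    rw [e1, e2, Real.sin_neg]; ring
  rw [← Finset.mul_sum, ← Finset.sum_mul] at h2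
  have h3 : m * dirichlet m t = ∑ l ∈ Finset.range m,
      Real.cos (((l : ℝ) - ((m : ℝ) - 1) / 2) * t) := by
    rw [dirichlet, mul_div_cancel₀ _ hm',
      ← Fin.sum_univ_eq_sum_range (fun l : ℕ => Real.cos (((l : ℝ) - ((m : ℝ) - 1) / 2) * t))]
    rfl
  rw [h3]; linarith

theorem dirichletDeriv_mul_sin {m : ℕ} (hm : m ≠ 0) (t : ℝ) :
    2 * dirichletDeriv m t * Real.sin (t / 2)
      = Real.cos (m * t / 2) - dirichlet m t * Real.cos (t / 2) := by
  have hm' : (m : ℝ) ≠ 0 := by exact_mod_cast hm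
  have h1 : HasDerivAt (fun t : ℝ => m * dirichlet m t * Real.sin (t / 2))
      (m * dirichletDeriv m t * Real.sin (t / 2)
        + m * dirichlet m t * (Real.cos (t / 2) * (1 / 2))) t :=
    ((hasDerivAt_dirichlet m t).const_mul (m : ℝ)).mul (((hasDerivAt_id t).div_const 2).sin)
  have h2 : HasDerivAt (fun t : ℝ => Real.sin (m * t / 2))
      (Real.cos (m * t / 2) * (m * 1 / 2)) t :=
    ((((hasDerivAt_id t).const_mul (m : ℝ))).div_const 2).sin
  have h3 := h1.unique ((funext (dirichlet_mul_sin hm) :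
    (fun t : ℝ => m * dirichlet m t * Real.sin (t / 2)) = fun t => Real.sin (m * t / 2)) ▸ h2)
  have h4 : (m : ℝ) * (2 * dirichletDeriv m t * Real.sin (t / 2))
      = m * (Real.cos (m * t / 2) - dirichlet m t * Real.cos (t / 2)) := by linarith
  exact mul_left_cancel₀ hm' h4

theorem dirichlet_neg (m : ℕ) (t : ℝ) : dirichlet m (-t) = dirichlet m t := by
  simp [dirichlet]

theorem dirichletDeriv_neg (m : ℕ) (t : ℝ) : dirichletDeriv m (-t) = -dirichletDeriv m t := by
  simp [dirichletDeriv, Finset.sum_neg_distrib, neg_div]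

theorem dirichlet_zero {m : ℕ} (hm : m ≠ 0) : dirichlet m 0 = 1 := by
  have hm' : (m : ℝ) ≠ 0 := by exact_mod_cast hm
  simp [dirichlet, hm']

theorem dirichlet_le_one (m : ℕ) (t : ℝ) : dirichlet m t ≤ 1 := by
  rw [dirichlet]
  apply div_le_one_of_le₀ _ (Nat.cast_nonneg m)
  calc _ ≤ ∑ _l : Fin m, (1 : ℝ) := Finset.sum_le_sum fun l _ => Real.cos_le_one _
    _ = m := by simp

theorem sum_freqIndex_sq (m : ℕ) :
    ∑ l : Fin m, freqIndex m l ^ 2 = (m : ℝ) * ((m : ℝ) ^ 2 - 1) / 12 := by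
  have h : ∀ n : ℕ, ∀ c : ℝ, ∑ l ∈ Finset.range n, ((l : ℝ) - c) ^ 2
      = (n : ℝ) * (n - 1) * (2 * n - 1) / 6 - c * n * (n - 1) + n * c ^ 2 := by
    intro n c
    induction n with
    | zero => simp
    | succ n ih => rw [Finset.sum_range_succ, ih]; push_cast; ring
  have h2 := h m (((m : ℝ) - 1) / 2)
  rw [← Fin.sum_univ_eq_sum_range (fun l : ℕ => ((l : ℝ) - ((m : ℝ) - 1) / 2) ^ 2)] at h2
  simp only [freqIndex]
  rw [h2]; ring

theorem sum_freqIndex_sq_le (m : ℕ) : ∑ l : Fin m, freqIndex m l ^ 2 ≤ (m : ℝ) ^ 3 / 12 := by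
  rw [sum_freqIndex_sq]
  have : (0 : ℝ) ≤ m := Nat.cast_nonneg m
  nlinarith

theorem freqIndex_sq_le {m : ℕ} (l : Fin m) : freqIndex m l ^ 2 ≤ (m : ℝ) ^ 2 / 4 := by
  have h1 : ((l : ℕ) : ℝ) + 1 ≤ m := by exact_mod_cast l.2
  have h0 : (0 : ℝ) ≤ (l : ℕ) := Nat.cast_nonneg _
  have h2 : |freqIndex m l| ≤ (m : ℝ) / 2 := by
    rw [abs_le, freqIndex]; constructor <;> linarith
  calc freqIndex m l ^ 2 = |freqIndex m l| ^ 2 := (sq_abs _).symm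
    _ ≤ ((m : ℝ) / 2) ^ 2 := by gcongr
    _ = _ := by ring

theorem neg_dirichletDeriv_le {m : ℕ} {t : ℝ} (ht : 0 ≤ t) :
    -dirichletDeriv m t ≤ (m : ℝ) ^ 2 / 12 * t := by
  rcases Nat.eq_zero_or_pos m with rfl | hm
  · simp [dirichletDeriv]
  have hm' : (0 : ℝ) < m := by exact_mod_cast hm
  have h1 : ∀ l : Fin m, freqIndex m l * Real.sin (freqIndex m l * t) ≤ freqIndex m l ^ 2 * t := by
    intro l
    calc freqIndex m l * Real.sin (freqIndex m l * t)
        ≤ |freqIndex m l| * |Real.sin (freqIndex m l * t)| := by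
          rw [← abs_mul]; exact le_abs_self _
      _ ≤ |freqIndex m l| * |freqIndex m l * t| :=
          mul_le_mul_of_nonneg_left Real.abs_sin_le_abs (abs_nonneg _)
      _ = freqIndex m l ^ 2 * t := by rw [abs_mul, abs_of_nonneg ht, ← sq_abs]; ring
  have h2 := Finset.sum_le_sum fun l (_ : l ∈ Finset.univ) => h1 l
  rw [← Finset.sum_mul] at h2
  have h3 := sum_freqIndex_sq_le m
  rw [dirichletDeriv, neg_div, neg_neg, div_le_iff₀ hm']
  calc _ ≤ _ := h2
    _ ≤ (m : ℝ) ^ 3 / 12 * t := by gcongr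
    _ = _ := by ring

theorem one_sub_le_dirichlet {m : ℕ} (hm : m ≠ 0) (t : ℝ) :
    1 - (m : ℝ) ^ 2 * t ^ 2 / 24 ≤ dirichlet m t := by
  have hm' : (0 : ℝ) < m := by positivity
  have h2 : ∑ l : Fin m, (1 - freqIndex m l ^ 2 * t ^ 2 / 2)
      ≤ ∑ l : Fin m, Real.cos (freqIndex m l * t) := by
    apply Finset.sum_le_sum
    intro l _
    have := Real.one_sub_sq_div_two_le_cos (x := freqIndex m l * t)
    rwa [mul_pow] at this
  rw [Finset.sum_sub_distrib, ← Finset.sum_div, ← Finset.sum_mul] at h2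
  simp only [Finset.sum_const, Finset.card_univ, Fintype.card_fin, nsmul_eq_mul, mul_one] at h2
  rw [dirichlet, le_div_iff₀ hm']
  have h3 := mul_le_mul_of_nonneg_right (sum_freqIndex_sq_le m) (sq_nonneg t)
  linarith

/-! ### Decay of the Dirichlet kernel -/

/-- The envelope `(m sin (t / 2))⁻²` of the squared Dirichlet kernel. -/
noncomputable def envelope (m : ℕ) (t : ℝ) : ℝ := 1 / (m * Real.sin (t / 2)) ^ 2

theorem envelope_nonneg (m : ℕ) (t : ℝ) : 0 ≤ envelope m t := by
  rw [envelope]; positivity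

theorem dirichlet_sq_le_envelope {m : ℕ} (hm : m ≠ 0) {t : ℝ} (ht : Real.sin (t / 2) ≠ 0) :
    dirichlet m t ^ 2 ≤ envelope m t := by
  have hm' : (m : ℝ) ≠ 0 := by exact_mod_cast hm
  have h0 : 0 < (m * Real.sin (t / 2)) ^ 2 := by positivity
  rw [envelope, le_div_iff₀ h0]
  calc _ = (m * dirichlet m t * Real.sin (t / 2)) ^ 2 := by ring
    _ = Real.sin (m * t / 2) ^ 2 := by rw [dirichlet_mul_sin hm]
    _ ≤ 1 := Real.sin_sq_le_one _

/-- Eliminating `D` from the two closed forms leaves `2 m D' S² = m S cos (m t / 2) - C sin (m t /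
2)`; Cauchy–Schwarz bounds the square of the right side by `(m S)² + 1`. -/
theorem dirichletDeriv_sq_le_envelope {m : ℕ} (hm : m ≠ 0) {t : ℝ}
    (ht : Real.sin (t / 2) ≠ 0) :
    dirichletDeriv m t ^ 2
      ≤ (m : ℝ) ^ 2 * (envelope m t * (1 + envelope m t) / 4) := by
  have hm' : (m : ℝ) ≠ 0 := by exact_mod_cast hm
  set S := Real.sin (t / 2) with hS
  set C := Real.cos (t / 2) with hC
  have h0 : 0 < (m * S) ^ 2 := by positivity
  have h1 := dirichlet_mul_sin hm t
  have h2 := dirichletDeriv_mul_sin hm t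
  rw [← hS] at h1
  rw [← hS, ← hC] at h2
  have h3 := Real.sin_sq_add_cos_sq (m * t / 2)
  have h4 : S ^ 2 + C ^ 2 = 1 := Real.sin_sq_add_cos_sq _
  have h5 : 2 * dirichletDeriv m t * S * (m * S)
      = m * S * Real.cos (m * t / 2) - Real.sin (m * t / 2) * C := by
    rw [h2, ← h1]; ring
  have h6 : (2 * dirichletDeriv m t * S * (m * S)) ^ 2 ≤ (m * S) ^ 2 + 1 := by
    rw [h5]
    have : (m * S * Real.cos (m * t / 2) - Real.sin (m * t / 2) * C) ^ 2
        ≤ ((m * S) ^ 2 + C ^ 2) * (Real.sin (m * t / 2) ^ 2 + Real.cos (m * t / 2) ^ 2) := by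
      nlinarith [sq_nonneg (m * S * Real.sin (m * t / 2) + Real.cos (m * t / 2) * C)]
    rw [h3] at this
    nlinarith [sq_nonneg S]
  have h7 : (m : ℝ) ^ 2 * (envelope m t * (1 + envelope m t) / 4)
      = ((m * S) ^ 2 + 1) / (4 * m ^ 2 * S ^ 4) := by
    rw [envelope, ← hS]; field_simp
  rw [h7, le_div_iff₀ (by positivity)]
  calc _ = (2 * dirichletDeriv m t * S * (m * S)) ^ 2 := by ring
    _ ≤ _ := h6

/-- Squaring `x cos x ≤ sin x` gives `x² ≤ sin² x (1 + x²)`. The additive `1` is harmless: in the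
envelope it is divided by `m²`. -/
theorem one_div_sin_sq_le {x : ℝ} (h0 : x ≠ 0) (h1 : |x| ≤ Real.pi / 2) :
    Real.sin x ≠ 0 ∧ 1 / Real.sin x ^ 2 ≤ 1 / x ^ 2 + 1 := by
  wlog hx : 0 < x generalizing x
  · have := this (x := -x) (by simpa) (by simpa) (by
      rcases lt_or_gt_of_ne h0 with h | h
      · linarith
      · exact absurd h hx)
    simpa using this
  rw [abs_of_pos hx] at h1
  have hs : 0 < Real.sin x := Real.sin_pos_of_pos_of_lt_pi hx (by linarith [Real.pi_pos])
  refine ⟨hs.ne', ?_⟩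
  have hc : 0 ≤ Real.cos x := Real.cos_nonneg_of_neg_pi_div_two_le_of_le
    (by linarith [Real.pi_pos]) h1
  have h2 : x * Real.cos x ≤ Real.sin x := by
    rcases h1.lt_or_eq with h | h
    · have h3 := Real.le_tan hx.le h
      have hc' : 0 < Real.cos x := Real.cos_pos_of_mem_Ioo ⟨by linarith [Real.pi_pos], h⟩
      rwa [Real.tan_eq_sin_div_cos, le_div_iff₀ hc'] at h3
    · rw [h, Real.cos_pi_div_two]; simp
  have h4 : (x * Real.cos x) ^ 2 ≤ Real.sin x ^ 2 := by gcongr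
  have h5 : x ^ 2 ≤ Real.sin x ^ 2 * (1 + x ^ 2) := by
    nlinarith [Real.sin_sq_add_cos_sq x]
  rw [div_add' _ _ _ (by positivity), div_le_div_iff₀ (by positivity) (by positivity)]
  nlinarith

theorem envelope_toReal_le (m : ℕ) {t : ℝ} (ht : (t : Real.Angle).toReal ≠ 0) :
    Real.sin (t / 2) ≠ 0 ∧
    envelope m t ≤ (4 / (t : Real.Angle).toReal ^ 2 + 1) / (m : ℝ) ^ 2 := by
  set r := (t : Real.Angle).toReal with hr
  obtain ⟨n, hn⟩ := Real.Angle.angle_eq_iff_two_pi_dvd_sub.1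
    (Real.Angle.coe_toReal (t : Real.Angle))
  have h1 : r / 2 = t / 2 + n * Real.pi := by rw [hr]; linarith
  have h2 : Real.sin (r / 2) ^ 2 = Real.sin (t / 2) ^ 2 := by
    rw [h1, Real.sin_add_int_mul_pi, mul_pow, ← zpow_natCast, ← zpow_mul, mul_comm n,
      zpow_mul]; simp
  have h3 : |r / 2| ≤ Real.pi / 2 := by
    rw [abs_div, abs_two]; linarith [Real.Angle.abs_toReal_le_pi (t : Real.Angle)]
  obtain ⟨h4, h5⟩ := one_div_sin_sq_le (div_ne_zero ht two_ne_zero) h3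
  rw [h2] at h5
  have h6 : Real.sin (t / 2) ≠ 0 := by
    intro h; rw [h] at h2; exact h4 (by simpa using h2)
  refine ⟨h6, ?_⟩
  rw [envelope, mul_pow, one_div, mul_inv, mul_comm, ← div_eq_mul_inv, ← one_div]
  gcongr
  calc _ ≤ _ := h5
    _ = _ := by rw [div_pow, one_div_div]; norm_num

/-! ### Taylor bounds for sine and cosine -/

theorem nonneg_of_hasDerivAt_nonneg {f f' : ℝ → ℝ} (hf : ∀ x, HasDerivAt f (f' x) x)
    (h0 : f 0 = 0) (h : ∀ x, 0 ≤ x → 0 ≤ f' x) {x : ℝ} (hx : 0 ≤ x) : 0 ≤ f x := by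
  have hmono : MonotoneOn f (Set.Ici 0) := by
    apply monotoneOn_of_hasDerivWithinAt_nonneg (convex_Ici 0)
      (fun x _ => (hf x).continuousAt.continuousWithinAt) (fun x _ => (hf x).hasDerivWithinAt)
    intro x hx
    rw [interior_Ici] at hx
    exact h x (le_of_lt hx)
  simpa [h0] using hmono (Set.mem_Ici.2 le_rfl) (Set.mem_Ici.2 hx) hx

theorem hasDerivAt_monomial (c : ℝ) (n : ℕ) (x : ℝ) :
    HasDerivAt (fun x : ℝ => c * x ^ (n + 1)) (c * ((n + 1) * x ^ n)) x := by
  simpa using (hasDerivAt_pow (n + 1) x).const_mul c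

/-- Each of the Taylor bounds from here on is the integral from `0` of the one before it, starting
from `1 - x² / 2 ≤ cos x`. -/
theorem sub_cube_le_sin {x : ℝ} (hx : 0 ≤ x) : x - x ^ 3 / 6 ≤ Real.sin x := by
  have := nonneg_of_hasDerivAt_nonneg (f := fun x => Real.sin x - (1 * x ^ (0 + 1) +
    (-1 / 6) * x ^ (2 + 1))) (fun x => (Real.hasDerivAt_sin x).sub
      ((hasDerivAt_monomial _ _ x).add (hasDerivAt_monomial _ _ x))) (by simp)
    (fun x _ => by
      have := Real.one_sub_sq_div_two_le_cos (x := x)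
      norm_num; linarith) hx
  norm_num at this; linarith

theorem cos_le_quartic {x : ℝ} (hx : 0 ≤ x) : Real.cos x ≤ 1 - x ^ 2 / 2 + x ^ 4 / 24 := by
  have := nonneg_of_hasDerivAt_nonneg (f := fun x => ((-1 / 2) * x ^ (1 + 1) +
    (1 / 24) * x ^ (3 + 1)) - (Real.cos x - 1)) (fun x =>
      ((hasDerivAt_monomial _ _ x).add (hasDerivAt_monomial _ _ x)).sub
        ((Real.hasDerivAt_cos x).sub_const 1)) (by simp)
    (fun x hx => by
      have := sub_cube_le_sin hx
      norm_num; linarith) hx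
  norm_num at this; linarith

theorem sin_le_quintic {x : ℝ} (hx : 0 ≤ x) :
    Real.sin x ≤ x - x ^ 3 / 6 + x ^ 5 / 120 := by
  have := nonneg_of_hasDerivAt_nonneg (f := fun x => (1 * x ^ (0 + 1) +
    (-1 / 6) * x ^ (2 + 1) + (1 / 120) * x ^ (4 + 1)) - Real.sin x) (fun x =>
      (((hasDerivAt_monomial _ _ x).add (hasDerivAt_monomial _ _ x)).add
        (hasDerivAt_monomial _ _ x)).sub (Real.hasDerivAt_sin x)) (by simp)
    (fun x hx => by
      have := cos_le_quartic hx
      norm_num; linarith) hx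
  norm_num at this; linarith

theorem sextic_le_cos {x : ℝ} (hx : 0 ≤ x) :
    1 - x ^ 2 / 2 + x ^ 4 / 24 - x ^ 6 / 720 ≤ Real.cos x := by
  have := nonneg_of_hasDerivAt_nonneg (f := fun x => (Real.cos x - 1) - ((-1 / 2) * x ^ (1 + 1) +
    (1 / 24) * x ^ (3 + 1) + (-1 / 720) * x ^ (5 + 1))) (fun x =>
      ((Real.hasDerivAt_cos x).sub_const 1).sub (((hasDerivAt_monomial _ _ x).add
        (hasDerivAt_monomial _ _ x)).add (hasDerivAt_monomial _ _ x))) (by simp)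
    (fun x hx => by
      have := sin_le_quintic hx
      norm_num; linarith) hx
  norm_num at this; linarith

theorem septic_le_sin {x : ℝ} (hx : 0 ≤ x) :
    x - x ^ 3 / 6 + x ^ 5 / 120 - x ^ 7 / 5040 ≤ Real.sin x := by
  have := nonneg_of_hasDerivAt_nonneg (f := fun x => Real.sin x - (1 * x ^ (0 + 1) +
    (-1 / 6) * x ^ (2 + 1) + (1 / 120) * x ^ (4 + 1) + (-1 / 5040) * x ^ (6 + 1))) (fun x =>
      (Real.hasDerivAt_sin x).sub ((((hasDerivAt_monomial _ _ x).add
        (hasDerivAt_monomial _ _ x)).add (hasDerivAt_monomial _ _ x)).add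
          (hasDerivAt_monomial _ _ x))) (by simp)
    (fun x hx => by
      have := sextic_le_cos hx
      norm_num; linarith) hx
  norm_num at this; linarith

theorem cos_le_octic {x : ℝ} (hx : 0 ≤ x) :
    Real.cos x ≤ 1 - x ^ 2 / 2 + x ^ 4 / 24 - x ^ 6 / 720 + x ^ 8 / 40320 := by
  have := nonneg_of_hasDerivAt_nonneg (f := fun x => ((-1 / 2) * x ^ (1 + 1) +
    (1 / 24) * x ^ (3 + 1) + (-1 / 720) * x ^ (5 + 1) + (1 / 40320) * x ^ (7 + 1))
      - (Real.cos x - 1)) (fun x =>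
      ((((hasDerivAt_monomial _ _ x).add (hasDerivAt_monomial _ _ x)).add
        (hasDerivAt_monomial _ _ x)).add (hasDerivAt_monomial _ _ x)).sub
        ((Real.hasDerivAt_cos x).sub_const 1)) (by simp)
    (fun x hx => by
      have := septic_le_sin hx
      norm_num; linarith) hx
  norm_num at this; linarith

/-! ### The Dirichlet kernel on its main lobe -/

/-- Here `3.8025 = 1.95²`, the value of `(m t / 2)²` at `m t = 3.9`, and `0.44392` is just below `2
* 0.9999 * 0.222`, as needed for `abs_dirichletDeriv_le`. -/
theorem cubic_le {z : ℝ} (h1 : z ≤ 3.8025) :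
    (z + 3.8025) / 3.9 * (1 / 3 - z / 30 + z ^ 2 / 720) ≤ 0.44392 := by
  have h2 : 0 ≤ (3.8025 - z) * (0.1199 - 0.02278 * z + z ^ 2 / 720) :=
    mul_nonneg (by linarith) (by nlinarith [sq_nonneg z])
  rw [div_mul_eq_mul_div, div_le_iff₀ (by norm_num)]
  nlinarith

theorem sinc_poly_bounds {z : ℝ} (h0 : 0 ≤ z) (h1 : z ≤ 3.8025) :
    0.4757 ≤ 1 - z / 6 + z ^ 2 / 120 - z ^ 3 / 5040 ∧
    1 - z / 6 + z ^ 2 / 120 - z ^ 3 / 5040 ≤ 1 := by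
  constructor <;> nlinarith [sq_nonneg z]

theorem sinc_deriv_poly_bound {z : ℝ} (h1 : z ≤ 3.8025) :
    0.2223 ≤ 0.33328 - z / 30 + z ^ 2 / 840 - z ^ 3 / 40320 := by
  nlinarith [sq_nonneg z]

/-- Lower bounds for `D` and `-D'` on the main lobe, with `z = (m t / 2) ^ 2`. -/
theorem mainLobe_lower {m : ℕ} (hm : 100 ≤ m) {t : ℝ} (h0 : 0 < t) (h1 : m * t ≤ 3.9) {z : ℝ}
    (hz : z = (m * t / 2) ^ 2) :
    1 - z / 6 + z ^ 2 / 120 - z ^ 3 / 5040 ≤ dirichlet m t ∧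
    m * (m * t / 2) * (0.33328 - z / 30 + z ^ 2 / 840 - z ^ 3 / 40320) / 2
      ≤ -dirichletDeriv m t := by
  have hm0 : m ≠ 0 := by omega
  have hm' : (100 : ℝ) ≤ m := by exact_mod_cast hm
  set y := m * t / 2 with hy
  set x := t / 2 with hx
  have hyx : y = m * x := by rw [hy, hx]; ring
  have hx0 : 0 < x := by positivity
  have hy0 : 0 < y := by positivity
  have hy1 : y ≤ 1.95 := by rw [hy]; linarith
  have hx1 : x ≤ 0.0195 := by nlinarith
  have hsx : Real.sin x ≤ x := Real.sin_le hx0.le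
  have hsx0 : 0 < Real.sin x := Real.sin_pos_of_pos_of_lt_pi hx0 (by linarith [Real.pi_gt_three])
  have hsy := septic_le_sin hy0.le
  have hcy := cos_le_octic hy0.le
  have hcx := Real.one_sub_sq_div_two_le_cos (x := x)
  have e1 : m * dirichlet m t * Real.sin x = Real.sin y := dirichlet_mul_sin hm0 t
  have e2 : 2 * dirichletDeriv m t * Real.sin x = Real.cos y - dirichlet m t * Real.cos x :=
    dirichletDeriv_mul_sin hm0 t
  have hz0 : 0 < z := by rw [hz]; positivity
  have hz1 : z ≤ 3.8025 := by rw [hz]; nlinarith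
  generalize dirichlet m t = D at *
  generalize dirichletDeriv m t = D' at *
  clear_value x y
  set A := 1 - z / 6 + z ^ 2 / 120 - z ^ 3 / 5040 with hA
  obtain ⟨hA0, hA1⟩ : 0.4757 ≤ A ∧ A ≤ 1 := sinc_poly_bounds hz0.le hz1
  replace hA0 : 0 < A := by linarith only [hA0]
  have hsy' : y * A ≤ Real.sin y := by
    rw [hA, hz]; linarith only [hsy]
  -- As `sin x ≤ x`, the kernel dominates `sin y / y`.
  have hAD : A ≤ D := by
    by_contra hlt
    push Not at hlt
    have : m * D * Real.sin x < y * A := by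
      calc m * D * Real.sin x < m * A * Real.sin x := by gcongr
        _ ≤ m * A * x := by gcongr
        _ = y * A := by rw [hyx]; ring
    linarith only [this, hsy', e1]
  refine ⟨hAD, ?_⟩
  -- The continuum limit would have `1 / 3` as constant term. Replacing `cos x` by `1` costs at most
  -- `z / 20000` because `m ≥ 100`, and `1 / 3 - 0.33328` covers this.
  set N := 0.33328 - z / 30 + z ^ 2 / 840 - z ^ 3 / 40320 with hN
  have hN0 : 0 < N := lt_of_lt_of_le (by norm_num) (sinc_deriv_poly_bound hz1)
  have hxz : x ^ 2 ≤ z / 10000 := by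
    rw [hz, hyx, mul_pow, le_div_iff₀ (by norm_num), mul_comm (x ^ 2)]
    gcongr
    nlinarith
  have hDc : A * (1 - x ^ 2 / 2) ≤ D * Real.cos x := by
    apply mul_le_mul hAD hcx _ (hA0.le.trans hAD)
    nlinarith only [hx0, hx1]
  have hcy' : Real.cos y ≤ 1 - z / 2 + z ^ 2 / 24 - z ^ 3 / 720 + z ^ 4 / 40320 := by
    rw [hz]; linarith only [hcy]
  have h3 : z * N ≤ D * Real.cos x - Real.cos y := by
    have h5 : A * (x ^ 2 / 2) ≤ 1 * (z / 10000 / 2) := by gcongr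
    have h4 : A - (1 - z / 2 + z ^ 2 / 24 - z ^ 3 / 720 + z ^ 4 / 40320)
        = z * N + z * (1 / 3 - 0.33328) := by
      rw [hN, hA]; ring
    linarith only [h5, h4, hDc, hcy', hz0]
  have h4 : z * N ≤ 2 * (-D') * Real.sin x := by linarith only [h3, e2]
  have hD'0 : 0 ≤ -D' := by
    by_contra hlt
    push Not at hlt
    have : (-D') * Real.sin x < 0 := mul_neg_of_neg_of_pos hlt hsx0
    linarith only [mul_pos hz0 hN0, this, h4]
  have h5 : z * N ≤ 2 * (-D') * x := h4.trans (by gcongr)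
  have hzz : z = y * (m * x) := by rw [hz, hyx]; ring
  rw [hzz] at h5
  have h6 : (m * y * N / 2) * x ≤ (-D') * x := by linarith only [h5]
  exact le_of_mul_le_mul_right h6 hx0

/-- Stronger than the linear bound `m² t / 12` near the edge of the lobe; it controls the term in
which `φ (ξ j)` leaks onto the other nodes. -/
theorem abs_dirichletDeriv_le {m : ℕ} (hm : 100 ≤ m) {t : ℝ} (h1 : m * |t| ≤ 3.9) :
    |dirichletDeriv m t| ≤ 0.222 * m := by
  wlog h0 : 0 ≤ t generalizing t
  · have := this (t := -t) (by simpa) (by linarith)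
    rwa [dirichletDeriv_neg, abs_neg] at this
  rw [abs_of_nonneg h0] at h1
  have hm0 : m ≠ 0 := by omega
  have hm' : (100 : ℝ) ≤ m := by exact_mod_cast hm
  rcases h0.eq_or_lt with rfl | h0
  · simp only [dirichletDeriv, mul_zero, Real.sin_zero, Finset.sum_const_zero, neg_zero,
      zero_div, abs_zero]
    positivity
  set z := (m * t / 2) ^ 2 with hz
  obtain ⟨-, hlow⟩ := mainLobe_lower hm h0 h1 hz
  set y := m * t / 2 with hy
  set x := t / 2 with hx
  have hyx : y = m * x := by rw [hy, hx]; ring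
  have hx0 : 0 < x := by positivity
  have hy0 : 0 < y := by positivity
  have hy1 : y ≤ 1.95 := by rw [hy]; linarith
  have hx1 : x ≤ 0.0195 := by nlinarith
  have hz0 : 0 < z := by rw [hz]; positivity
  have hz1 : z ≤ 3.8025 := by rw [hz]; nlinarith
  have hD'0 : 0 ≤ -dirichletDeriv m t := by
    refine le_trans ?_ hlow
    have : 0 ≤ 0.33328 - z / 30 + z ^ 2 / 840 - z ^ 3 / 40320 :=
      le_trans (by norm_num) (sinc_deriv_poly_bound hz1)
    positivity
  clear hlow
  rw [abs_of_nonpos (by linarith)]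
  have hsx : x - x ^ 3 / 6 ≤ Real.sin x := sub_cube_le_sin hx0.le
  have hsx0 : 0 < Real.sin x := Real.sin_pos_of_pos_of_lt_pi hx0 (by linarith [Real.pi_gt_three])
  have hsy := sin_le_quintic hy0.le
  have hcy := sextic_le_cos hy0.le
  have hxc : x * Real.cos x ≤ Real.sin x := by
    have hlt : x < Real.pi / 2 := by linarith [Real.pi_gt_three]
    have h3 := Real.le_tan hx0.le hlt
    have hc' : 0 < Real.cos x := Real.cos_pos_of_mem_Ioo ⟨by linarith, hlt⟩
    rwa [Real.tan_eq_sin_div_cos, le_div_iff₀ hc'] at h3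
  have e1 : m * dirichlet m t * Real.sin x = Real.sin y := dirichlet_mul_sin hm0 t
  have e2 : 2 * dirichletDeriv m t * Real.sin x = Real.cos y - dirichlet m t * Real.cos x :=
    dirichletDeriv_mul_sin hm0 t
  generalize dirichlet m t = D at *
  generalize dirichletDeriv m t = D' at *
  clear_value x z y
  have hD0 : 0 ≤ D := by
    have : 0 ≤ Real.sin y := Real.sin_nonneg_of_nonneg_of_le_pi hy0.le
      (by linarith [Real.pi_gt_three])
    rw [← e1] at this
    by_contra hlt
    push Not at hlt
    have h2 : m * D * Real.sin x < 0 := by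
      exact mul_neg_of_neg_of_pos (mul_neg_of_pos_of_neg (by linarith only [hm']) hlt) hsx0
    linarith only [h2, this]
  have hDc : y * (D * Real.cos x) ≤ Real.sin y := by
    rw [← e1, hyx]
    calc _ = m * D * (x * Real.cos x) := by ring
      _ ≤ _ := by gcongr
  have h4 : y * (2 * (-D') * Real.sin x) ≤ y * (z * (1 / 3 - z / 30 + z ^ 2 / 720)) := by
    have : y * (2 * (-D') * Real.sin x) = y * (D * Real.cos x) - y * Real.cos y := by
      rw [← mul_sub]; congr 1; linarith only [e2]
    have h9 := mul_le_mul_of_nonneg_left hcy hy0.le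
    have h10 : y * (z * (1 / 3 - z / 30 + z ^ 2 / 720))
        = y - y ^ 3 / 6 + y ^ 5 / 120 - y * (1 - y ^ 2 / 2 + y ^ 4 / 24 - y ^ 6 / 720) := by
      rw [hz]; ring
    linarith only [this, h9, h10, hDc, hsy]
  have h5 := le_of_mul_le_mul_left h4 hy0
  have h6 : 2 * (-D') * (0.9999 * x) ≤ 2 * (-D') * Real.sin x := by
    have : 0.9999 * x ≤ Real.sin x := by
      nlinarith only [hsx, hx0, hx1, mul_pos hx0 hx0]
    gcongr
  have hzz : z = y * (m * x) := by rw [hz, hyx]; ring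
  have h7 : (2 * 0.9999 * (-D')) * x ≤ (y * m * (1 / 3 - z / 30 + z ^ 2 / 720)) * x := by
    calc _ = 2 * (-D') * (0.9999 * x) := by ring
      _ ≤ z * (1 / 3 - z / 30 + z ^ 2 / 720) := h6.trans h5
      _ = _ := by nth_rewrite 1 [hzz]; ring
  have h8 := le_of_mul_le_mul_right h7 hx0
  have h9 : y * (1 / 3 - z / 30 + z ^ 2 / 720) ≤ 0.44392 := by
    have hzy : z = y ^ 2 := hz
    -- The tangent to the square root at `z = 1.95²` turns the estimate into one for a polynomial in
    -- `z`.
    have hyz : y ≤ (z + 3.8025) / 3.9 := by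
      rw [le_div_iff₀ (by norm_num), hzy]; nlinarith only [sq_nonneg (y - 1.95)]
    have hpos : 0 ≤ 1 / 3 - z / 30 + z ^ 2 / 720 := by
      nlinarith only [hz1, sq_nonneg z]
    calc _ ≤ (z + 3.8025) / 3.9 * (1 / 3 - z / 30 + z ^ 2 / 720) := by gcongr
      _ ≤ _ := cubic_le hz1
  have h10 : y * m * (1 / 3 - z / 30 + z ^ 2 / 720) ≤ 0.44392 * m := by
    calc _ = m * (y * (1 / 3 - z / 30 + z ^ 2 / 720)) := by ring
      _ ≤ m * 0.44392 := by gcongr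
      _ = _ := by ring
  have h11 : 0 ≤ -D' := hD'0
  linarith only [h8, h10, h11, hm']

/-- The derivative of `-D ^ 2` on the main lobe. -/
theorem mainLobe_deriv {m : ℕ} (hm : 100 ≤ m) {t : ℝ} (h0 : 0 ≤ t) (h1 : m * t ≤ 3.9) :
    0.0527 * (m ^ 2 * t) ≤ -(2 * dirichlet m t * dirichletDeriv m t) ∧
    (m * t ≤ 1.5 → 0.13 * (m ^ 2 * t) ≤ -(2 * dirichlet m t * dirichletDeriv m t)) ∧
    -(2 * dirichlet m t * dirichletDeriv m t) ≤ m ^ 2 * t / 6 := by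
  have hm' : (100 : ℝ) ≤ m := by exact_mod_cast hm
  rcases h0.eq_or_lt with rfl | h0
  · simp [dirichletDeriv]
  set z := (m * t / 2) ^ 2 with hz
  obtain ⟨hD, hD'⟩ := mainLobe_lower hm h0 h1 hz
  have hup := neg_dirichletDeriv_le (m := m) h0.le
  have hD1 := dirichlet_le_one m t
  have hmt : 0 < m * t := by positivity
  have hz0 : 0 < z := by rw [hz]; positivity
  have hz1 : z ≤ 3.8025 := by rw [hz]; nlinarith
  set D := dirichlet m t
  set D' := dirichletDeriv m t
  have hA : 0.4757 ≤ 1 - z / 6 + z ^ 2 / 120 - z ^ 3 / 5040 := (sinc_poly_bounds hz0.le hz1).1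
  have hN : 0.2223 ≤ 0.33328 - z / 30 + z ^ 2 / 840 - z ^ 3 / 40320 :=
    sinc_deriv_poly_bound hz1
  have key : ∀ a n : ℝ, 0 ≤ a → 0 ≤ n → a ≤ D →
      n ≤ 0.33328 - z / 30 + z ^ 2 / 840 - z ^ 3 / 40320 →
      (a * n / 2) * (m ^ 2 * t) ≤ -(2 * D * D') := by
    intro a n ha hn haD hnN
    have h2 : m * (m * t / 2) * n / 2 ≤ -D' := by
      refine le_trans ?_ hD'
      gcongr
    have h3 : 0 ≤ m * (m * t / 2) * n / 2 := by positivity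
    calc (a * n / 2) * (m ^ 2 * t) = 2 * (a * (m * (m * t / 2) * n / 2)) := by ring
      _ ≤ 2 * (D * -D') := by
        have : 0 ≤ D := ha.trans haD
        gcongr
      _ = _ := by ring
  have hmm : 0 < m ^ 2 * t := by positivity
  refine ⟨?_, ?_, ?_⟩
  · have := key 0.4757 0.2223 (by norm_num) (by norm_num) (hA.trans hD) hN
    linarith only [this, hmm]
  · intro h2
    have hz2 : z ≤ 0.5625 := by rw [hz]; nlinarith
    have hA2 : 0.906 ≤ 1 - z / 6 + z ^ 2 / 120 - z ^ 3 / 5040 := by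
      nlinarith only [sq_nonneg z, hz0, hz2]
    have hN2 : 0.314 ≤ 0.33328 - z / 30 + z ^ 2 / 840 - z ^ 3 / 40320 := by
      nlinarith only [sq_nonneg z, hz0, hz2]
    have := key 0.906 0.314 (by norm_num) (by norm_num) (hA2.trans hD) hN2
    linarith only [this, hmm]
  · have hD0 : 0 ≤ D := by linarith
    have : D * -D' ≤ 1 * ((m : ℝ) ^ 2 / 12 * t) :=
      mul_le_mul hD1 hup (by
        refine le_trans ?_ hD'
        have : 0 ≤ 0.33328 - z / 30 + z ^ 2 / 840 - z ^ 3 / 40320 := by linarith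
        positivity) zero_le_one
    linarith

/-! ### Steering vectors -/

theorem freqIndex_rev {m : ℕ} (l : Fin m) : freqIndex m l.rev = -freqIndex m l := by
  have h : ((l.rev : ℕ) : ℝ) = (m : ℝ) - ((l : ℕ) + 1) := by
    rw [Fin.val_rev, Nat.cast_sub (by omega)]; push_cast; ring
  rw [freqIndex, freqIndex, h]; ring

theorem sum_sin_freqIndex (m : ℕ) (t : ℝ) : ∑ l : Fin m, Real.sin (freqIndex m l * t) = 0 := by
  have h : ∑ l : Fin m, Real.sin (freqIndex m l * t)
      = ∑ l : Fin m, Real.sin (freqIndex m l.rev * t) :=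
    (Equiv.sum_comp Fin.revPerm (fun l : Fin m => Real.sin (freqIndex m l * t))).symm
  simp only [freqIndex_rev, neg_mul, Real.sin_neg, Finset.sum_neg_distrib] at h
  linarith

/-- The frequencies are symmetric about zero, so the sines cancel and the Gram matrix is real. -/
theorem inner_steering (m : ℕ) (r t : ℝ) :
    inner ℂ (steering m r) (steering m t) = (dirichlet m (t - r) : ℂ) := by
  have h : ∀ l : Fin m, inner ℂ (steering m r l) (steering m t l)
      = ((Real.cos (freqIndex m l * (t - r)) / m : ℝ) : ℂ)
        + ((Real.sin (freqIndex m l * (t - r)) / m : ℝ) : ℂ) * Complex.I := by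
    intro l
    have e0 : ((1 / Real.sqrt m : ℝ) : ℂ) * ((1 / Real.sqrt m : ℝ) : ℂ) = ((1 / m : ℝ) : ℂ) := by
      rw [← Complex.ofReal_mul, div_mul_div_comm, Real.mul_self_sqrt (Nat.cast_nonneg m), one_mul]
    have e1 : Complex.exp (Complex.I * (freqIndex m l : ℂ) * (t : ℂ))
        * (starRingEnd ℂ) (Complex.exp (Complex.I * (freqIndex m l : ℂ) * (r : ℂ)))
        = Complex.exp (((freqIndex m l * (t - r) : ℝ) : ℂ) * Complex.I) := by
      rw [← Complex.exp_conj, ← Complex.exp_add]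
      congr 1
      simp only [map_mul, Complex.conj_I, Complex.conj_ofReal]
      push_cast; ring
    rw [RCLike.inner_apply]
    simp only [steering, map_mul, Complex.conj_ofReal]
    rw [mul_mul_mul_comm, e0, e1, Complex.exp_mul_I, ← Complex.ofReal_cos, ← Complex.ofReal_sin]
    push_cast; ring
  rw [PiLp.inner_apply, Finset.sum_congr rfl fun l _ => h l, Finset.sum_add_distrib,
    ← Finset.sum_mul, ← Complex.ofReal_sum, ← Complex.ofReal_sum, ← Finset.sum_div,
    ← Finset.sum_div, sum_sin_freqIndex, dirichlet]
  simp

/-- The derivative of the steering vector. -/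
noncomputable def steeringDeriv (m : ℕ) (t : ℝ) : EuclideanSpace ℂ (Fin m) :=
  WithLp.toLp 2 fun l => Complex.I * (freqIndex m l : ℂ) * steering m t l

theorem hasDerivAt_steering (m : ℕ) (t : ℝ) :
    HasDerivAt (steering m) (steeringDeriv m t) t := by
  have h : HasDerivAt (fun t : ℝ => fun l : Fin m => steering m t l)
      (fun l => Complex.I * (freqIndex m l : ℂ) * steering m t l) t := by
    rw [hasDerivAt_pi]
    intro l
    have h1 : HasDerivAt (fun t : ℝ => Complex.I * (freqIndex m l : ℂ) * (t : ℂ))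
        (Complex.I * (freqIndex m l : ℂ) * 1) t :=
      (Complex.ofRealCLM.hasDerivAt (x := t)).const_mul _
    have h2 := (h1.cexp).const_mul ((1 / Real.sqrt m : ℝ) : ℂ)
    exact h2.congr_deriv (by simp only [steering]; ring)
  have h2 := ((PiLp.continuousLinearEquiv 2 ℝ (fun _ : Fin m => ℂ)).symm :
    (Fin m → ℂ) →L[ℝ] EuclideanSpace ℂ (Fin m)).hasFDerivAt.comp_hasDerivAt t h
  exact h2

theorem norm_steering {m : ℕ} (hm : m ≠ 0) (t : ℝ) : ‖steering m t‖ = 1 := by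
  have h := norm_sq_eq_re_inner (𝕜 := ℂ) (steering m t)
  rw [inner_steering, sub_self, dirichlet_zero hm] at h
  have h2 : ‖steering m t‖ ^ 2 = 1 := by simpa using h
  nlinarith [norm_nonneg (steering m t)]

theorem inner_steering_steeringDeriv (m : ℕ) (r t : ℝ) :
    inner ℂ (steering m r) (steeringDeriv m t) = (dirichletDeriv m (t - r) : ℂ) := by
  have h1 := (hasDerivAt_const t (steering m r)).inner ℂ (hasDerivAt_steering m t)
  have h2 : HasDerivAt (fun t : ℝ => ((dirichlet m (t - r) : ℝ) : ℂ))
      (dirichletDeriv m (t - r) : ℂ) t :=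
    ((hasDerivAt_dirichlet m (t - r)).comp_sub_const t r).ofReal_comp
  simp only [inner_steering, inner_zero_left, add_zero] at h1
  exact h1.unique h2

theorem norm_sq_weighted_steering {m : ℕ} (w : Fin m → ℂ) (t : ℝ) :
    ‖(WithLp.toLp 2 fun l => w l * steering m t l : EuclideanSpace ℂ (Fin m))‖ ^ 2
      = (∑ l, ‖w l‖ ^ 2) / m := by
  rw [EuclideanSpace.norm_sq_eq, Finset.sum_div]
  refine Finset.sum_congr rfl fun l _ => ?_
  have h : ‖steering m t l‖ ^ 2 = 1 / m := by
    have : Complex.I * (freqIndex m l : ℂ) * (t : ℂ) = ((freqIndex m l * t : ℝ) : ℂ) * Complex.I := by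
      push_cast; ring
    simp only [steering]
    rw [this, norm_mul, Complex.norm_exp_ofReal_mul_I, Complex.norm_real, mul_one, Real.norm_eq_abs,
      sq_abs, div_pow, Real.sq_sqrt (Nat.cast_nonneg m), one_pow]
  rw [norm_mul, mul_pow, h]; ring

theorem norm_steeringDeriv_sq_le {m : ℕ} (hm : m ≠ 0) (t : ℝ) :
    ‖steeringDeriv m t‖ ^ 2 ≤ (m : ℝ) ^ 2 / 12 := by
  have hm' : (0 : ℝ) < m := by positivity
  rw [steeringDeriv, norm_sq_weighted_steering, div_le_iff₀ hm']
  have h : ∀ l : Fin m, ‖Complex.I * (freqIndex m l : ℂ)‖ ^ 2 = freqIndex m l ^ 2 := by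
    intro l; simp
  rw [Finset.sum_congr rfl fun l _ => h l]
  have := sum_freqIndex_sq_le m
  linarith

theorem norm_exp_sub_one_sub_le (x : ℝ) :
    ‖Complex.exp (Complex.I * x) - 1 - Complex.I * x‖ ≤ x ^ 2 / 2 := by
  wlog hx : 0 ≤ x generalizing x
  · have := this (-x) (by linarith)
    rw [← RCLike.norm_conj] at this
    simpa [← Complex.exp_conj, ← sub_eq_add_neg] using this
  have hd : ∀ y : ℝ, HasDerivAt (fun y : ℝ => Complex.exp (Complex.I * y) - 1 - Complex.I * y)
      (Complex.exp (Complex.I * y) * (Complex.I * 1) - Complex.I * 1) y := by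
    intro y
    have h1 : HasDerivAt (fun y : ℝ => Complex.I * (y : ℂ)) (Complex.I * 1) y :=
      (Complex.ofRealCLM.hasDerivAt (x := y)).const_mul _
    exact (h1.cexp.sub_const 1).sub h1
  have := image_norm_le_of_norm_deriv_right_le_deriv_boundary (a := 0) (b := x)
    (f := fun y : ℝ => Complex.exp (Complex.I * y) - 1 - Complex.I * y)
    (B := fun y => y ^ 2 / 2) (B' := fun y => y)
    (fun y _ => (hd y).continuousAt.continuousWithinAt)
    (fun y _ => (hd y).hasDerivWithinAt) (by simp)
    (fun y => by simpa using (hasDerivAt_pow 2 y).div_const 2)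
    (fun y hy => by
      rw [mul_one, ← sub_one_mul, norm_mul, Complex.norm_I, mul_one,
        Complex.norm_exp_I_mul_ofReal_sub_one, norm_mul, Real.norm_eq_abs, Real.norm_eq_abs]
      have h2 : |Real.sin (y / 2)| ≤ |y / 2| := Real.abs_sin_le_abs
      rw [abs_of_nonneg (div_nonneg hy.1 zero_le_two)] at h2
      rw [abs_two]; linarith) (Set.right_mem_Icc.2 hx)
  simpa using this

/-- Coordinatewise the remainder is at most `(k (r - t))² / 2` relative to the entry. In `∑ k⁴`, one
factor `k²` is bounded by `m² / 4` and the other is summed to `m³ / 12`, whence `192 = 4 * 4 * 12`.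
-/
theorem norm_steering_taylor_sq_le {m : ℕ} (hm : m ≠ 0) (t r : ℝ) :
    ‖steering m r - steering m t - ((r - t : ℝ) : ℂ) • steeringDeriv m t‖ ^ 2
      ≤ (m : ℝ) ^ 4 * (r - t) ^ 4 / 192 := by
  have hm' : (0 : ℝ) < m := by positivity
  have h1 : steering m r - steering m t - ((r - t : ℝ) : ℂ) • steeringDeriv m t
      = WithLp.toLp 2 fun l => (Complex.exp (Complex.I * ((freqIndex m l * (r - t) : ℝ) : ℂ)) - 1
        - Complex.I * ((freqIndex m l * (r - t) : ℝ) : ℂ)) * steering m t l := by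
    ext l
    simp only [steeringDeriv, PiLp.sub_apply, PiLp.smul_apply, smul_eq_mul]
    have h2 : steering m r l
        = Complex.exp (Complex.I * ((freqIndex m l * (r - t) : ℝ) : ℂ)) * steering m t l := by
      simp only [steering]
      rw [mul_left_comm, ← Complex.exp_add]
      congr 2
      push_cast; ring
    rw [h2]; push_cast; ring
  rw [h1, norm_sq_weighted_steering, div_le_iff₀ hm']
  have h3 : ∀ l : Fin m, ‖Complex.exp (Complex.I * ((freqIndex m l * (r - t) : ℝ) : ℂ)) - 1
      - Complex.I * ((freqIndex m l * (r - t) : ℝ) : ℂ)‖ ^ 2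
      ≤ freqIndex m l ^ 2 * ((m : ℝ) ^ 2 / 4 * (r - t) ^ 4 / 4) := by
    intro l
    calc _ ≤ ((freqIndex m l * (r - t)) ^ 2 / 2) ^ 2 := by
          gcongr; exact norm_exp_sub_one_sub_le _
      _ = freqIndex m l ^ 2 * (freqIndex m l ^ 2 * (r - t) ^ 4 / 4) := by ring
      _ ≤ _ := by gcongr; exact freqIndex_sq_le l
  refine (Finset.sum_le_sum fun l _ => h3 l).trans ?_
  rw [← Finset.sum_mul]
  calc _ ≤ (m : ℝ) ^ 3 / 12 * ((m : ℝ) ^ 2 / 4 * (r - t) ^ 4 / 4) := by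
        gcongr; exact sum_freqIndex_sq_le m
    _ = _ := by ring

/-! ### Distances on the torus -/

theorem dist_coe_le (a b : ℝ) : dist (a : Real.Angle) (b : Real.Angle) ≤ |a - b| := by
  simpa using (isLeast_dist a b).2 ⟨0, by simp⟩

theorem dist_coe_eq {a b : ℝ} (h : |a - b| ≤ Real.pi) :
    dist (a : Real.Angle) (b : Real.Angle) = |a - b| := by
  rw [dist_eq_norm]
  have hp := Real.pi_pos
  refine (AddCircle.norm_coe_eq_abs_iff (2 * Real.pi) (x := a - b) (by positivity : 2 * Real.pi ≠ 0)).2 ?_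
  rw [abs_of_pos (show 0 < 2 * Real.pi by positivity)]; linarith

theorem dist_eq_abs_toReal (u v : Real.Angle) : dist u v = |(u - v).toReal| := by
  have h := dist_coe_eq (a := (u - v).toReal) (b := 0)
    (by simpa using Real.Angle.abs_toReal_le_pi (u - v))
  rw [Real.Angle.coe_toReal, Real.Angle.coe_zero, sub_zero] at h
  rw [← h, dist_zero_right, dist_eq_norm]

theorem envelope_le_of_dist (m : ℕ) {t r d : ℝ} (hd : 0 < d)
    (h : d ≤ dist (t : Real.Angle) (r : Real.Angle)) :
    Real.sin ((t - r) / 2) ≠ 0 ∧ envelope m (t - r) ≤ (4 / d ^ 2 + 1) / (m : ℝ) ^ 2 := by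
  rw [dist_eq_abs_toReal, ← Real.Angle.coe_sub] at h
  have h0 : ((t - r : ℝ) : Real.Angle).toReal ≠ 0 := abs_pos.1 (hd.trans_le h)
  obtain ⟨h1, h2⟩ := envelope_toReal_le m h0
  refine ⟨h1, h2.trans ?_⟩
  rw [← sq_abs ((t - r : ℝ) : Real.Angle).toReal]
  gcongr

/-! ### Sums over separated points -/

/-- Separated points are determined by their side and by their rounded distance. -/
theorem side_floor_injective {s : ℕ} (x : Fin s → Real.Angle) {Δ : ℝ} (hΔ : 0 < Δ)
    (hsep : ∀ j k, j ≠ k → Δ ≤ dist (x j) (x k)) (p : Real.Angle) :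
    Function.Injective fun k : Fin s =>
      (decide (0 ≤ (x k - p).toReal), ⌊dist (x k) p / Δ⌋₊) := by
  have hbd : ∀ k, (⌊dist (x k) p / Δ⌋₊ : ℝ) * Δ ≤ |(x k - p).toReal| ∧
      |(x k - p).toReal| < ((⌊dist (x k) p / Δ⌋₊ : ℝ) + 1) * Δ := by
    intro k
    rw [← dist_eq_abs_toReal]
    constructor
    · rw [← le_div_iff₀ hΔ]; exact Nat.floor_le (by positivity)
    · rw [← div_lt_iff₀ hΔ]; exact Nat.lt_floor_add_one _
  intro j k hjk
  by_contra hne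
  have h1 := hsep j k hne
  have h2 : dist (x j) (x k) ≤ |(x j - p).toReal - (x k - p).toReal| := by
    have := dist_coe_le (x j - p).toReal (x k - p).toReal
    rwa [Real.Angle.coe_toReal, Real.Angle.coe_toReal, dist_sub_right] at this
  obtain ⟨h3, h4⟩ := Prod.mk.inj hjk
  have hj := hbd j
  have hk := hbd k
  rw [h4] at hj
  have h5 : (0 ≤ (x j - p).toReal ↔ 0 ≤ (x k - p).toReal) := by simpa using h3
  have h6 : |(x j - p).toReal - (x k - p).toReal| < Δ := by
    rw [abs_lt]
    by_cases h7 : 0 ≤ (x j - p).toReal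
    · rw [abs_of_nonneg h7] at hj
      rw [abs_of_nonneg (h5.1 h7)] at hk
      constructor <;> linarith
    · have h8 : ¬ 0 ≤ (x k - p).toReal := fun h => h7 (h5.2 h)
      push Not at h7 h8
      rw [abs_of_neg h7] at hj
      rw [abs_of_neg h8] at hk
      constructor <;> linarith
  linarith

/-- Each ring of width `Δ` about `p` holds at most one point per side, so the sum is at most twice
one over ring numbers; the quadratic part is then bounded by `ζ(2) = π² / 6`. -/
theorem sum_le_of_separated {s : ℕ} (x : Fin s → Real.Angle) {Δ : ℝ} (hΔ : 0 < Δ)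
    (hsep : ∀ j k, j ≠ k → Δ ≤ dist (x j) (x k)) (p : Real.Angle) {A B : ℝ} (hA : 0 ≤ A)
    (hB : 0 ≤ B) :
    ∑ k with 1 ≤ ⌊dist (x k) p / Δ⌋₊, (A / (⌊dist (x k) p / Δ⌋₊ : ℝ) ^ 2 + B)
      ≤ A * (Real.pi ^ 2 / 3) + B * (2 * Real.pi / Δ) := by
  set n : Fin s → ℕ := fun k => ⌊dist (x k) p / Δ⌋₊ with hn
  set N : ℕ := ⌊Real.pi / Δ⌋₊ with hN
  set S : Finset (Fin s) := Finset.univ.filter fun k => 1 ≤ n k with hS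
  set f : Fin s → Bool × ℕ := fun k => (decide (0 ≤ (x k - p).toReal), n k) with hf
  have hinj : Set.InjOn f S := (side_floor_injective x hΔ hsep p).injOn
  have hmaps : S.image f ⊆ Finset.univ ×ˢ Finset.Icc 1 N := by
    intro y hy
    obtain ⟨k, hk, rfl⟩ := Finset.mem_image.1 hy
    rw [Finset.mem_product, Finset.mem_Icc]
    refine ⟨Finset.mem_univ _, (Finset.mem_filter.1 hk).2, Nat.floor_le_floor ?_⟩
    gcongr
    rw [dist_eq_abs_toReal]
    exact Real.Angle.abs_toReal_le_pi _
  have hsum : ∑ i ∈ Finset.Icc 1 N, 1 / (i : ℝ) ^ 2 ≤ Real.pi ^ 2 / 6 :=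
    sum_le_hasSum _ (fun i _ => by positivity) hasSum_zeta_two
  have hNle : (N : ℝ) ≤ Real.pi / Δ := Nat.floor_le (by positivity)
  calc ∑ k ∈ S, (A / (n k : ℝ) ^ 2 + B)
      = ∑ y ∈ S.image f, (A / (y.2 : ℝ) ^ 2 + B) := by
        rw [Finset.sum_image hinj]
    _ ≤ ∑ y ∈ (Finset.univ : Finset Bool) ×ˢ Finset.Icc 1 N, (A / (y.2 : ℝ) ^ 2 + B) :=
        Finset.sum_le_sum_of_subset_of_nonneg hmaps fun y _ _ => by positivity
    _ = 2 * (A * ∑ i ∈ Finset.Icc 1 N, 1 / (i : ℝ) ^ 2 + B * N) := by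
        rw [Finset.sum_product]
        simp only [Finset.sum_const, Finset.card_univ, Fintype.card_bool]
        rw [Finset.sum_add_distrib, Finset.mul_sum]
        simp [div_eq_mul_inv, mul_comm]
        ring
    _ ≤ 2 * (A * (Real.pi ^ 2 / 6) + B * (Real.pi / Δ)) := by gcongr
    _ = _ := by ring

/-- The sum of the envelopes over the points at distance at least `8π / m` from `p`. -/
theorem sum_envelope_le {m s : ℕ} (hm : 100 ≤ m) (ξ : Fin s → ℝ)
    (hsep : ∀ j k, j ≠ k → 8 * Real.pi / m ≤ dist (ξ j : Real.Angle) (ξ k : Real.Angle))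
    (p : Real.Angle) (t : ℝ) {c : ℝ} (hc : 0 < c)
    (h : ∀ k, 1 ≤ ⌊dist (ξ k : Real.Angle) p / (8 * Real.pi / m)⌋₊ →
      c * dist (ξ k : Real.Angle) p ≤ dist (t : Real.Angle) (ξ k : Real.Angle)) :
    ∑ k with 1 ≤ ⌊dist (ξ k : Real.Angle) p / (8 * Real.pi / m)⌋₊, envelope m (t - ξ k)
      ≤ 1 / (48 * c ^ 2) + 1 / 400 := by
  have hm' : (100 : ℝ) ≤ m := by exact_mod_cast hm
  have hpi := Real.pi_pos
  have hΔ : 0 < 8 * Real.pi / m := by positivity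
  -- `A` and `B` come from `(4 / d² + 1) / m²` at `d = c n (8π / m)`, the least distance from `t` to
  -- a point of ring `n`.
  have hle := sum_le_of_separated (fun k => (ξ k : Real.Angle)) hΔ hsep p
    (A := 1 / (16 * Real.pi ^ 2 * c ^ 2)) (B := 1 / (m : ℝ) ^ 2) (by positivity) (by positivity)
  calc _ ≤ _ := Finset.sum_le_sum (fun k hk => ?_)
    _ ≤ _ := hle
    _ = 1 / (48 * c ^ 2) + 1 / (4 * m) := by field_simp; ring
    _ ≤ _ := by
      gcongr
      linarith
  have hk1 := (Finset.mem_filter.1 hk).2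
  have hn : (1 : ℝ) ≤ (⌊dist (ξ k : Real.Angle) p / (8 * Real.pi / m)⌋₊ : ℝ) := by
    exact_mod_cast hk1
  set n : ℝ := (⌊dist (ξ k : Real.Angle) p / (8 * Real.pi / m)⌋₊ : ℝ) with hnn
  have h1 : n * (8 * Real.pi / m) ≤ dist (ξ k : Real.Angle) p := by
    rw [← le_div_iff₀ hΔ]; exact Nat.floor_le (by positivity)
  have h2 : c * (n * (8 * Real.pi / m)) ≤ dist (t : Real.Angle) (ξ k : Real.Angle) :=
    le_trans (by gcongr) (h k hk1)
  refine (envelope_le_of_dist m (by positivity) h2).2.trans (le_of_eq ?_)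
  have : n ≠ 0 := by linarith
  field_simp
  ring

/-! ### The Gram matrix of separated steering vectors -/

theorem norm_geom_sum_exp_le (n : ℕ) {t : ℝ} (ht : Real.sin (t / 2) ≠ 0) :
    ‖∑ a ∈ Finset.range n, Complex.exp (Complex.I * t) ^ a‖ ≤ 1 / |Real.sin (t / 2)| := by
  have h1 := geom_sum_mul (Complex.exp (Complex.I * t)) n
  have h2 : ‖Complex.exp (Complex.I * t) - 1‖ = 2 * |Real.sin (t / 2)| := by
    rw [Complex.norm_exp_I_mul_ofReal_sub_one, norm_mul, Real.norm_eq_abs, Real.norm_eq_abs,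
      abs_two]
  have h3 : ‖Complex.exp (Complex.I * t) ^ n - 1‖ ≤ 2 := by
    have h4 : ‖Complex.exp (Complex.I * t)‖ = 1 := by
      rw [mul_comm]; exact Complex.norm_exp_ofReal_mul_I t
    calc _ ≤ ‖Complex.exp (Complex.I * t) ^ n‖ + ‖(1 : ℂ)‖ := norm_sub_le _ _
      _ = 2 := by rw [norm_pow, h4]; norm_num
  rw [← h1, norm_mul, h2] at h3
  have h4 : 0 < |Real.sin (t / 2)| := abs_pos.2 ht
  rw [le_div_iff₀ h4]
  linarith

/-- Schur's test: `2 a_j a_k ≤ a_j² + a_k²`, and by symmetry of `w` both halves are row sums. -/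
theorem sum_mul_mul_le_of_sum_le {s : ℕ} (w : Fin s → Fin s → ℝ) (a : Fin s → ℝ) {R : ℝ}
    (hw : ∀ j k, 0 ≤ w j k) (hsymm : ∀ j k, w j k = w k j)
    (hR : ∀ j, ∑ k with k ≠ j, w j k ≤ R) :
    ∑ j, ∑ k with k ≠ j, a j * a k * w j k ≤ R * ∑ j, a j ^ 2 := by
  have h1 : ∑ j, ∑ k with k ≠ j, a j * a k * w j k
      ≤ ∑ j, ∑ k with k ≠ j, (a j ^ 2 * w j k / 2 + a k ^ 2 * w j k / 2) := by
    refine Finset.sum_le_sum fun j _ => Finset.sum_le_sum fun k _ => ?_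
    nlinarith [mul_nonneg (hw j k) (sq_nonneg (a j - a k))]
  have h2 : ∑ j, ∑ k with k ≠ j, a k ^ 2 * w j k / 2
      = ∑ j, ∑ k with k ≠ j, a j ^ 2 * w j k / 2 := by
    simp only [Finset.sum_filter]
    rw [Finset.sum_comm]
    refine Finset.sum_congr rfl fun j _ => Finset.sum_congr rfl fun k _ => ?_
    rw [hsymm k j]
    simp only [ne_comm]
  simp only [Finset.sum_add_distrib] at h1
  rw [h2, ← Finset.sum_add_distrib] at h1
  refine h1.trans ?_
  rw [Finset.mul_sum]
  refine Finset.sum_le_sum fun j _ => ?_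
  rw [← Finset.sum_add_distrib]
  calc _ = a j ^ 2 * ∑ k with k ≠ j, w j k := by
        rw [Finset.mul_sum]; exact Finset.sum_congr rfl fun k _ => by ring
    _ ≤ a j ^ 2 * R := by gcongr; exact hR j
    _ = _ := by ring

/-- Summing over `a + b` makes the kernel a product of two geometric sums, so off the diagonal it is
at most `1 / sin²`, which is summable over separated points. A single geometric sum would only decay
like `1 / |sin|` and lose a logarithm. -/
theorem sum_norm_sq_expSum_ge {s : ℕ} (ξ : Fin s → ℝ) (c : Fin s → ℂ) (A B : ℕ) {R : ℝ}
    (hsin : ∀ j k, k ≠ j → Real.sin ((ξ j - ξ k) / 2) ≠ 0)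
    (hR : ∀ j, ∑ k with k ≠ j, 1 / Real.sin ((ξ j - ξ k) / 2) ^ 2 ≤ R) :
    ((A : ℝ) * B - R) * ∑ j, ‖c j‖ ^ 2 ≤ ∑ b ∈ Finset.range B, ∑ a ∈ Finset.range A,
      ‖∑ k, c k * Complex.exp (Complex.I * ξ k) ^ (a + b)‖ ^ 2 := by
  set z : Fin s → Fin s → ℂ := fun j k => Complex.exp (Complex.I * ((ξ j - ξ k : ℝ) : ℂ)) with hz
  set M : Fin s → Fin s → ℂ := fun j k =>
    (∑ a ∈ Finset.range A, z j k ^ a) * ∑ b ∈ Finset.range B, z j k ^ b with hM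
  have h1 : ((∑ b ∈ Finset.range B, ∑ a ∈ Finset.range A,
      ‖∑ k, c k * Complex.exp (Complex.I * ξ k) ^ (a + b)‖ ^ 2 : ℝ) : ℂ)
      = ∑ j, ∑ k, c j * (starRingEnd ℂ) (c k) * M j k := by
    have hterm : ∀ n : ℕ, ((‖∑ k, c k * Complex.exp (Complex.I * ξ k) ^ n‖ ^ 2 : ℝ) : ℂ)
        = ∑ j, ∑ k, c j * (starRingEnd ℂ) (c k) * z j k ^ n := by
      intro n
      rw [Complex.ofReal_pow, ← Complex.mul_conj', map_sum, Finset.sum_mul_sum]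
      refine Finset.sum_congr rfl fun j _ => Finset.sum_congr rfl fun k _ => ?_
      rw [map_mul, mul_mul_mul_comm, map_pow, ← mul_pow, ← Complex.exp_conj, ← Complex.exp_add]
      congr 3
      simp only [map_mul, Complex.conj_I, Complex.conj_ofReal]
      push_cast; ring
    push_cast
    simp only [← Complex.ofReal_pow, hterm]
    rw [Finset.sum_congr rfl fun b _ => Finset.sum_comm, Finset.sum_comm]
    refine Finset.sum_congr rfl fun j _ => ?_
    rw [Finset.sum_congr rfl fun b _ => Finset.sum_comm, Finset.sum_comm]
    refine Finset.sum_congr rfl fun k _ => ?_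
    rw [hM]
    simp only
    rw [Finset.sum_mul_sum, Finset.mul_sum, Finset.sum_comm]
    refine Finset.sum_congr rfl fun a _ => ?_
    rw [Finset.mul_sum]
    exact Finset.sum_congr rfl fun b _ => by rw [pow_add]
  have hdiag : ∀ j, (c j * (starRingEnd ℂ) (c j) * M j j).re = A * B * ‖c j‖ ^ 2 := by
    intro j
    have : M j j = ((A * B : ℝ) : ℂ) := by simp [hM, hz]
    rw [this, Complex.mul_conj', ← Complex.ofReal_pow, ← Complex.ofReal_mul, Complex.ofReal_re]
    ring
  have hoff : ∀ j k, k ≠ j → -(‖c j‖ * ‖c k‖ * (1 / Real.sin ((ξ j - ξ k) / 2) ^ 2))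
      ≤ (c j * (starRingEnd ℂ) (c k) * M j k).re := by
    intro j k hjk
    refine (neg_le_neg ?_).trans (neg_le_of_abs_le (Complex.abs_re_le_norm _))
    rw [norm_mul, norm_mul, RCLike.norm_conj, hM]
    simp only
    rw [norm_mul, ← sq_abs (Real.sin _), ← one_div_pow, sq]
    have hs := hsin j k hjk
    gcongr
    · exact norm_geom_sum_exp_le A hs
    · exact norm_geom_sum_exp_le B hs
  have h2 : ∑ b ∈ Finset.range B, ∑ a ∈ Finset.range A,
      ‖∑ k, c k * Complex.exp (Complex.I * ξ k) ^ (a + b)‖ ^ 2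
      = ∑ j, ∑ k, (c j * (starRingEnd ℂ) (c k) * M j k).re := by
    have := congrArg Complex.re h1
    rw [Complex.ofReal_re] at this
    rw [this]; simp only [Complex.re_sum]
  have h3 : ∑ j, (A * B * ‖c j‖ ^ 2 +
      ∑ k with k ≠ j, -(‖c j‖ * ‖c k‖ * (1 / Real.sin ((ξ j - ξ k) / 2) ^ 2)))
      ≤ ∑ j, ∑ k, (c j * (starRingEnd ℂ) (c k) * M j k).re := by
    refine Finset.sum_le_sum fun j _ => ?_
    rw [← Finset.add_sum_erase _ _ (Finset.mem_univ j), hdiag, Finset.filter_ne']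
    gcongr with k hk
    exact hoff j k (Finset.ne_of_mem_erase hk)
  have h4 := sum_mul_mul_le_of_sum_le (fun j k => 1 / Real.sin ((ξ j - ξ k) / 2) ^ 2)
    (fun j => ‖c j‖) (fun j k => by positivity) (fun j k => by
      rw [← neg_sub, neg_div, Real.sin_neg, neg_sq]) hR
  rw [h2]
  refine le_trans ?_ h3
  simp only [Finset.sum_neg_distrib, Finset.sum_add_distrib, ← Finset.mul_sum]
  linarith

/-- For each shift `b` the indices `a + b` are distinct and below `m`. -/
theorem sum_norm_sq_shift_le (F : ℕ → ℝ) (hF : ∀ n, 0 ≤ F n) (A B m : ℕ) (h : A + B ≤ m + 1) :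
    ∑ b ∈ Finset.range B, ∑ a ∈ Finset.range A, F (a + b) ≤ B * ∑ l ∈ Finset.range m, F l := by
  calc _ ≤ ∑ _b ∈ Finset.range B, ∑ l ∈ Finset.range m, F l := by
        refine Finset.sum_le_sum fun b hb => ?_
        rw [← Finset.sum_image (g := fun a => a + b) (f := F)
          (fun _ _ _ _ h => Nat.add_right_cancel h)]
        refine Finset.sum_le_sum_of_subset_of_nonneg ?_ fun n _ _ => hF n
        intro l hl
        obtain ⟨a, ha, rfl⟩ := Finset.mem_image.1 hl
        rw [Finset.mem_range] at *
        omega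
    _ = _ := by simp

/-- The lower Riesz bound for steering vectors at separated points. -/
theorem gram_lower {m s : ℕ} (hm : 100 ≤ m) (ξ : Fin s → ℝ) (c : Fin s → ℂ)
    (hsin : ∀ j k, k ≠ j → Real.sin ((ξ j - ξ k) / 2) ≠ 0)
    (hR : ∀ j, ∑ k with k ≠ j, envelope m (ξ j - ξ k) ≤ 7 / 300) :
    0.694 * ∑ k, ‖c k‖ ^ 2 ≤ ‖∑ k, c k • steering m (ξ k)‖ ^ 2 := by
  have hm' : (100 : ℝ) ≤ m := by exact_mod_cast hm
  set d : Fin s → ℂ := fun k => c k * Complex.exp (((-((m : ℝ) - 1) / 2 * ξ k : ℝ) : ℂ) * Complex.I)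
    with hd
  have hdn : ∀ k, ‖d k‖ = ‖c k‖ := fun k => by
    rw [hd]; simp only; rw [norm_mul, Complex.norm_exp_ofReal_mul_I, mul_one]
  set F : ℕ → ℝ := fun l => ‖∑ k, d k * Complex.exp (Complex.I * ξ k) ^ l‖ ^ 2 with hF
  have h1 : ‖∑ k, c k • steering m (ξ k)‖ ^ 2 = (∑ l ∈ Finset.range m, F l) / m := by
    rw [EuclideanSpace.norm_sq_eq, ← Fin.sum_univ_eq_sum_range, Finset.sum_div]
    refine Finset.sum_congr rfl fun l _ => ?_
    have h2 : (∑ k, c k • steering m (ξ k)) l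
        = ((1 / Real.sqrt m : ℝ) : ℂ) * ∑ k, d k * Complex.exp (Complex.I * ξ k) ^ (l : ℕ) := by
      rw [WithLp.ofLp_sum, Finset.sum_apply, Finset.mul_sum]
      refine Finset.sum_congr rfl fun k _ => ?_
      simp only [steering, PiLp.smul_apply, smul_eq_mul, hd, freqIndex]
      rw [← Complex.exp_nat_mul, mul_assoc (c k), ← Complex.exp_add, mul_left_comm]
      congr 3
      push_cast; ring
    rw [h2, norm_mul, mul_pow, Complex.norm_real, Real.norm_eq_abs, sq_abs, div_pow,
      Real.sq_sqrt (Nat.cast_nonneg m)]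
    ring
  -- With `A = m + 1 - B` the resulting constant is `(A - R / B) / m`, where `R = 7 m² / 300`. It is
  -- largest near `B = √R ≈ 0.153 m`.
  set B : ℕ := ⌈0.15 * (m : ℝ)⌉₊ with hB
  have hB1 : 0.15 * (m : ℝ) ≤ B := Nat.le_ceil _
  have hB2 : (B : ℝ) < 0.15 * m + 1 := Nat.ceil_lt_add_one (by positivity)
  have hBm : B ≤ m + 1 := by
    have : (B : ℝ) ≤ ((m + 1 : ℕ) : ℝ) := by push_cast; linarith
    exact_mod_cast this
  have hA : (((m + 1 - B : ℕ) : ℕ) : ℝ) = m + 1 - B := by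
    rw [Nat.cast_sub hBm]; push_cast; ring
  have h3 := sum_norm_sq_expSum_ge ξ d (m + 1 - B) B (R := 7 / 300 * (m : ℝ) ^ 2) hsin
    (fun j => by
      have h4 := mul_le_mul_of_nonneg_right (hR j) (sq_nonneg (m : ℝ))
      rw [Finset.sum_mul] at h4
      refine le_trans (le_of_eq (Finset.sum_congr rfl fun k hk => ?_)) h4
      have := hsin j k (Finset.mem_filter.1 hk).2
      rw [envelope]; field_simp)
  have h5 := sum_norm_sq_shift_le F (fun n => by positivity) (m + 1 - B) B m (by omega)
  simp only [hdn] at h3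
  have h6 := h3.trans h5
  rw [hA] at h6
  have hBpos : (0 : ℝ) < B := by linarith
  rw [h1, le_div_iff₀ (by linarith)]
  set C := ∑ j, ‖c j‖ ^ 2 with hC
  have hC0 : 0 ≤ C := Finset.sum_nonneg fun j _ => by positivity
  have h7 : 0.694 * m * B ≤ (m + 1 - B) * B - 7 / 300 * (m : ℝ) ^ 2 := by
    nlinarith
  have h8 : B * (0.694 * C * m) ≤ B * ∑ l ∈ Finset.range m, F l := by
    refine le_trans ?_ h6
    calc _ = (0.694 * m * B) * C := by ring
      _ ≤ _ := by gcongr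
  exact le_of_mul_le_mul_left h8 hBpos

/-- The norm of an orthogonal projection onto the span of vectors with a lower Riesz bound. -/
theorem norm_starProjection_sq_le {E : Type*} [NormedAddCommGroup E] [InnerProductSpace ℂ E]
    {s : ℕ} (v : Fin s → E) (U : Submodule ℂ E) [U.HasOrthogonalProjection]
    (hU : U = Submodule.span ℂ (Set.range v)) {lam : ℝ} (hlam : 0 < lam)
    (h : ∀ c : Fin s → ℂ, lam * ∑ k, ‖c k‖ ^ 2 ≤ ‖∑ k, c k • v k‖ ^ 2) (w : E) :
    lam * ‖U.starProjection w‖ ^ 2 ≤ ∑ k, ‖inner ℂ (v k) w‖ ^ 2 := by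
  set u := U.starProjection w with hu
  have hmem : u ∈ Submodule.span ℂ (Set.range v) := hU ▸ Submodule.starProjection_apply_mem U w
  obtain ⟨c, hc⟩ := (Submodule.mem_span_range_iff_exists_fun ℂ).1 hmem
  -- Expand `‖u‖² = ⟨u, w⟩` in the coefficients of `u`; Cauchy–Schwarz and the Riesz bound for `c`
  -- then finish.
  have h1 : ‖u‖ ^ 2 ≤ ∑ k, ‖c k‖ * ‖inner ℂ (v k) w‖ := by
    have h2 : ((‖u‖ ^ 2 : ℝ) : ℂ) = inner ℂ u w := by
      have h3 : inner ℂ (w - u) u = 0 :=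
        Submodule.starProjection_inner_eq_zero w u (Submodule.starProjection_apply_mem U w)
      have h4 : inner ℂ u w = inner ℂ u u + inner ℂ u (w - u) := by
        rw [← inner_add_right]; simp
      rw [h4, ← inner_conj_symm u (w - u), h3, map_zero, add_zero, inner_self_eq_norm_sq_to_K]
      push_cast; rfl
    have h5 : inner ℂ u w = ∑ k, (starRingEnd ℂ) (c k) * inner ℂ (v k) w := by
      rw [← hc, sum_inner]
      exact Finset.sum_congr rfl fun k _ => by rw [inner_smul_left]
    have h6 : ‖inner ℂ u w‖ = ‖u‖ ^ 2 := by
      rw [← h2, Complex.norm_real, Real.norm_of_nonneg (by positivity)]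
    rw [← h6, h5]
    refine (norm_sum_le _ _).trans (Finset.sum_le_sum fun k _ => ?_)
    rw [norm_mul, RCLike.norm_conj]
  have h2 := h c
  rw [hc] at h2
  have h3 := Finset.sum_mul_sq_le_sq_mul_sq Finset.univ (fun k => ‖c k‖)
    (fun k => ‖inner ℂ (v k) w‖)
  set X := ∑ k, ‖c k‖ ^ 2
  set Y := ∑ k, ‖inner ℂ (v k) w‖ ^ 2
  have hY : 0 ≤ Y := Finset.sum_nonneg fun k _ => by positivity
  have h4 : (‖u‖ ^ 2) ^ 2 ≤ X * Y := le_trans (by gcongr) h3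
  rcases (sq_nonneg ‖u‖).eq_or_lt with h0 | h0
  · rw [← h0, mul_zero]; exact hY
  · have h5 : lam * (‖u‖ ^ 2) ^ 2 ≤ ‖u‖ ^ 2 * Y := by
      calc _ ≤ lam * (X * Y) := by gcongr
        _ = lam * X * Y := by ring
        _ ≤ _ := by gcongr
    have h6 : ‖u‖ ^ 2 * (lam * ‖u‖ ^ 2) ≤ ‖u‖ ^ 2 * Y := by linarith
    exact le_of_mul_le_mul_left h6 h0

/-! ### Landscape functions -/

theorem fourierSubspace_eq_span {m s : ℕ} (hm : m ≠ 0) (x : Fin s → Real.Angle) :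
    fourierSubspace m x = Submodule.span ℂ (Set.range fun k => steering m (x k).toReal) := by
  have hm' : (0 : ℝ) < m := by positivity
  have hsq : ((Real.sqrt m : ℝ) : ℂ) * ((1 / Real.sqrt m : ℝ) : ℂ) = 1 := by
    rw [← Complex.ofReal_mul, mul_one_div_cancel (Real.sqrt_pos.2 hm').ne', Complex.ofReal_one]
  have key : ∀ z : EuclideanSpace ℂ (Fin s), Matrix.toEuclideanLin (fourierMatrix m x) z
      = ∑ k, (z k * ((Real.sqrt m : ℝ) : ℂ)) • steering m (x k).toReal := by
    intro z
    ext l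
    rw [WithLp.ofLp_sum, Finset.sum_apply]
    simp only [Matrix.toLpLin_apply, Matrix.mulVec, dotProduct, fourierMatrix, Matrix.of_apply,
      PiLp.smul_apply, smul_eq_mul, steering]
    refine Finset.sum_congr rfl fun k _ => ?_
    rw [mul_assoc (z k), ← mul_assoc ((Real.sqrt m : ℝ) : ℂ), hsq, one_mul, mul_comm]
  apply le_antisymm
  · rintro _ ⟨z, rfl⟩
    rw [key]
    exact Submodule.sum_mem _ fun k _ => Submodule.smul_mem _ _ (Submodule.subset_span ⟨k, rfl⟩)
  · rw [Submodule.span_le]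
    rintro _ ⟨k, rfl⟩
    refine ⟨EuclideanSpace.single k ((1 / Real.sqrt m : ℝ) : ℂ), ?_⟩
    rw [key, Finset.sum_eq_single k]
    · rw [PiLp.single_apply, if_pos rfl, mul_comm, hsq, one_smul]
    · intro l _ hl
      rw [PiLp.single_apply, if_neg hl, zero_mul, zero_smul]
    · exact fun h => absurd (Finset.mem_univ k) h

/-- The derivative of the landscape function. -/
noncomputable def landscapeDeriv {m : ℕ} (W : Submodule ℂ (EuclideanSpace ℂ (Fin m))) (t : ℝ) : ℝ :=
  -(2 * (inner ℂ (steeringDeriv m t) (W.starProjection (steering m t))).re)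

theorem norm_sq_starProjection {m : ℕ} (W : Submodule ℂ (EuclideanSpace ℂ (Fin m)))
    (v : EuclideanSpace ℂ (Fin m)) :
    ‖W.starProjection v‖ ^ 2 = (inner ℂ v (W.starProjection v)).re := by
  have h : W.starProjection (W.starProjection v) = W.starProjection v :=
    Submodule.starProjection_eq_self_iff.2 (Submodule.starProjection_apply_mem W v)
  rw [norm_sq_eq_re_inner (𝕜 := ℂ), Submodule.inner_starProjection_left_eq_right, h]
  rfl

theorem hasDerivAt_landscape {m : ℕ} (W : Submodule ℂ (EuclideanSpace ℂ (Fin m))) (t : ℝ) :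
    HasDerivAt (fun t : ℝ => landscape W (t : Real.Angle)) (landscapeDeriv W t) t := by
  have h0 := hasDerivAt_steering m t
  have h1 : HasDerivAt (fun t => W.starProjection (steering m t))
      (W.starProjection (steeringDeriv m t)) t :=
    (W.starProjection.restrictScalars ℝ).hasFDerivAt.comp_hasDerivAt t h0
  have h2 := h0.inner ℂ h1
  have h3 := Complex.reCLM.hasFDerivAt.comp_hasDerivAt t h2
  have h4 := h3.const_sub 1
  have h5 : (fun t : ℝ => landscape W (t : Real.Angle))
      = fun t : ℝ => 1 - (Complex.reCLM ∘ fun t =>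
        inner ℂ (steering m t) (W.starProjection (steering m t))) t := by
    funext r
    rw [landscape_coe, norm_sq_starProjection]
    rfl
  rw [h5]
  refine h4.congr_deriv ?_
  rw [landscapeDeriv, Complex.reCLM_apply, Complex.add_re,
    ← Submodule.inner_starProjection_left_eq_right, ← inner_conj_symm, Complex.conj_re]
  ring

theorem torusDeriv_landscape {m : ℕ} (W : Submodule ℂ (EuclideanSpace ℂ (Fin m))) (t : ℝ) :
    torusDeriv (landscape W) (t : Real.Angle) = landscapeDeriv W t := by
  rw [torusDeriv_landscape_coe, ← (hasDerivAt_landscape W t).deriv]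
  simp only [landscape_coe]

theorem norm_steeringDeriv_le {m : ℕ} (hm : m ≠ 0) (t : ℝ) :
    ‖steeringDeriv m t‖ ≤ 0.28868 * m := by
  refine abs_le_of_sq_le_sq' ?_ (by positivity) |>.2
  refine (norm_steeringDeriv_sq_le hm t).trans ?_
  nlinarith [sq_nonneg (m : ℝ)]

theorem abs_landscape_sub_le {m : ℕ} (hm : m ≠ 0)
    (U W : Submodule ℂ (EuclideanSpace ℂ (Fin m))) (t : ℝ) :
    |landscape W (t : Real.Angle) - landscape U (t : Real.Angle)| ≤ sinTheta U W := by
  rw [landscape_coe, landscape_coe, norm_sq_starProjection, norm_sq_starProjection]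
  have h : 1 - (inner ℂ (steering m t) (W.starProjection (steering m t))).re
      - (1 - (inner ℂ (steering m t) (U.starProjection (steering m t))).re)
      = (inner ℂ (steering m t) ((U.starProjection - W.starProjection) (steering m t))).re := by
    rw [sub_apply, inner_sub_right, Complex.sub_re]; ring
  rw [h]
  refine (Complex.abs_re_le_norm _).trans ((norm_inner_le_norm _ _).trans ?_)
  have := (U.starProjection - W.starProjection).le_opNorm (steering m t)
  rw [norm_steering hm, mul_one] at this
  rw [norm_steering hm, one_mul]
  exact this

/-- The derivative is a bilinear expression in `φ'` and `φ`, with `‖φ'‖ ≤ m / √12` and `‖φ‖ = 1`. -/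
theorem abs_landscapeDeriv_sub_le {m : ℕ} (hm : m ≠ 0)
    (U W : Submodule ℂ (EuclideanSpace ℂ (Fin m))) (t : ℝ) :
    |landscapeDeriv W t - landscapeDeriv U t| ≤ 0.57736 * sinTheta U W * m := by
  have h : landscapeDeriv W t - landscapeDeriv U t
      = 2 * (inner ℂ (steeringDeriv m t)
        ((U.starProjection - W.starProjection) (steering m t))).re := by
    rw [landscapeDeriv, landscapeDeriv, sub_apply, inner_sub_right,
      Complex.sub_re]
    ring
  rw [h, abs_mul, abs_two]
  have h1 := (U.starProjection - W.starProjection).le_opNorm (steering m t)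
  rw [norm_steering hm, mul_one] at h1
  have h2 : |(inner ℂ (steeringDeriv m t)
      ((U.starProjection - W.starProjection) (steering m t))).re|
      ≤ 0.28868 * m * sinTheta U W :=
    (Complex.abs_re_le_norm _).trans ((norm_inner_le_norm _ _).trans
      (mul_le_mul (norm_steeringDeriv_le hm t) h1 (norm_nonneg _) (by positivity)))
  linarith

theorem landscape_nonneg {m : ℕ} (hm : m ≠ 0) (W : Submodule ℂ (EuclideanSpace ℂ (Fin m)))
    (t : Real.Angle) : 0 ≤ landscape W t := by
  have h1 := W.norm_starProjection_apply_le (steering m t.toReal)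
  rw [norm_steering hm] at h1
  rw [landscape]
  nlinarith [norm_nonneg (W.starProjection (steering m t.toReal))]

/-! ### The landscape function of a separated set -/

section separated

variable {m s : ℕ} {ξ : Fin s → ℝ}

theorem separated_floor_iff (hm : 100 ≤ m)
    (hsep : ∀ j k, j ≠ k → 8 * Real.pi / m ≤ dist (ξ j : Real.Angle) (ξ k : Real.Angle))
    (j k : Fin s) :
    1 ≤ ⌊dist (ξ k : Real.Angle) (ξ j : Real.Angle) / (8 * Real.pi / m)⌋₊ ↔ k ≠ j := by
  have hm' : (100 : ℝ) ≤ m := by exact_mod_cast hm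
  have hpi := Real.pi_pos
  constructor
  · rintro h rfl
    simp at h
  · intro h
    rw [Nat.one_le_floor_iff, one_le_div (by positivity)]
    exact hsep k j h

theorem separated_envelope (hm : 100 ≤ m)
    (hsep : ∀ j k, j ≠ k → 8 * Real.pi / m ≤ dist (ξ j : Real.Angle) (ξ k : Real.Angle)) :
    (∀ j k, k ≠ j → Real.sin ((ξ j - ξ k) / 2) ≠ 0) ∧
    ∀ j, ∑ k with k ≠ j, envelope m (ξ j - ξ k) ≤ 7 / 300 := by
  have hm' : (100 : ℝ) ≤ m := by exact_mod_cast hm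
  have hpi := Real.pi_pos
  constructor
  · intro j k hjk
    exact (envelope_le_of_dist m (d := 8 * Real.pi / m) (by positivity) (hsep j k hjk.symm)).1
  · intro j
    have h := sum_envelope_le hm ξ hsep (ξ j) (ξ j) (c := 1) one_pos
      (fun k _ => by rw [one_mul, dist_comm])
    simp only [separated_floor_iff hm hsep] at h
    refine h.trans (by norm_num)

theorem separated_projection (hm : 100 ≤ m)
    (hsep : ∀ j k, j ≠ k → 8 * Real.pi / m ≤ dist (ξ j : Real.Angle) (ξ k : Real.Angle))
    (U : Submodule ℂ (EuclideanSpace ℂ (Fin m)))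
    (hU : U = Submodule.span ℂ (Set.range fun k => steering m (ξ k)))
    (w : EuclideanSpace ℂ (Fin m)) :
    0.694 * ‖U.starProjection w‖ ^ 2 ≤ ∑ k, ‖inner ℂ (steering m (ξ k)) w‖ ^ 2 :=
  norm_starProjection_sq_le _ U hU (by norm_num)
    (fun c => gram_lower hm ξ c (separated_envelope hm hsep).1 (separated_envelope hm hsep).2) w

theorem far_sum_le (hm : 100 ≤ m)
    (hsep : ∀ j k, j ≠ k → 8 * Real.pi / m ≤ dist (ξ j : Real.Angle) (ξ k : Real.Angle))
    {t : ℝ} (ht : ∀ k, 3.9 / m ≤ dist (t : Real.Angle) (ξ k : Real.Angle)) :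
    ∑ k, envelope m (t - ξ k) ≤ 0.312 := by
  have hm' : (100 : ℝ) ≤ m := by exact_mod_cast hm
  have hpi := Real.pi_gt_three
  have hΔ : 0 < 8 * Real.pi / m := by positivity
  have h1 := sum_envelope_le hm ξ hsep (t : Real.Angle) t (c := 1) one_pos
    (fun k _ => by rw [one_mul, dist_comm])
  set n : Fin s → ℕ := fun k => ⌊dist (ξ k : Real.Angle) (t : Real.Angle) / (8 * Real.pi / m)⌋₊
    with hn
  set T : Finset (Fin s) := Finset.univ.filter fun k => ¬ 1 ≤ n k with hT
  have hm2 : 1 / (m : ℝ) ^ 2 ≤ 1 / 10000 := by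
    apply one_div_le_one_div_of_le (by norm_num); nlinarith
  have hall : ∀ d : ℝ, 0 < d → ∀ k, d / m ≤ dist (t : Real.Angle) (ξ k : Real.Angle) →
      envelope m (t - ξ k) ≤ 4 / d ^ 2 + 1 / 10000 := by
    intro d hd k hk
    refine (envelope_le_of_dist m (by positivity) hk).2.trans ?_
    have : (4 / (d / m) ^ 2 + 1) / (m : ℝ) ^ 2 = 4 / d ^ 2 + 1 / (m : ℝ) ^ 2 := by
      field_simp
    rw [this]; gcongr
  -- Points in ring `0` are distinguished by their side of `t`.
  have hcard : T.card ≤ 2 := by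
    have hinj := side_floor_injective (fun k => (ξ k : Real.Angle)) hΔ hsep (t : Real.Angle)
    have := Finset.card_le_card_of_injOn (s := T) (t := (Finset.univ : Finset Bool))
      (fun k => decide (0 ≤ ((ξ k : Real.Angle) - (t : Real.Angle)).toReal))
      (fun _ _ => Finset.mem_univ _) (fun j hj k hk hjk => hinj (Prod.ext hjk (by
        have h2 := (Finset.mem_filter.1 hj).2
        have h3 := (Finset.mem_filter.1 hk).2
        simp only [hn] at h2 h3
        simp only
        omega)))
    simpa using this
  have hTsum : ∑ k ∈ T, envelope m (t - ξ k) ≤ 0.2886 := by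
    rcases T.eq_empty_or_nonempty with h0 | h0
    · rw [h0, Finset.sum_empty]; norm_num
    obtain ⟨k₀, hk₀, hmin⟩ := T.exists_min_image
      (fun k => dist (t : Real.Angle) (ξ k : Real.Angle)) h0
    rw [← Finset.add_sum_erase _ _ hk₀]
    have h2 := hall 3.9 (by norm_num) k₀ (ht k₀)
    have h3 : ∀ k ∈ T.erase k₀, envelope m (t - ξ k) ≤ 0.0255 := by
      intro k hk
      have h4 := hsep k₀ k (Finset.ne_of_mem_erase hk).symm
      have h5 := dist_triangle_left (ξ k₀ : Real.Angle) (ξ k : Real.Angle) (t : Real.Angle)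
      have h6 := hmin k (Finset.mem_of_mem_erase hk)
      -- Only the nearest node can be as close as `3.9 / m`: the other one in ring `0` is at least
      -- half the separation `8π / m` away.
      have h7 : 12.56 / m ≤ dist (t : Real.Angle) (ξ k : Real.Angle) := by
        have : 2 * (12.56 / (m : ℝ)) ≤ 8 * Real.pi / m := by
          rw [← mul_div_assoc]
          gcongr ?_ / _
          linarith [Real.pi_gt_d2]
        linarith
      refine (hall 12.56 (by norm_num) k h7).trans (by norm_num)
    have h4 := Finset.sum_le_card_nsmul _ _ _ h3
    have h5 : (T.erase k₀).card ≤ 1 := by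
      rw [Finset.card_erase_of_mem hk₀]; omega
    have h6 : ((T.erase k₀).card : ℝ) ≤ 1 := by exact_mod_cast h5
    rw [nsmul_eq_mul] at h4
    norm_num at h2 h4 ⊢
    linarith
  rw [← Finset.sum_filter_add_sum_filter_not Finset.univ (fun k => 1 ≤ n k)]
  calc _ ≤ 1 / (48 * 1 ^ 2) + 1 / 400 + 0.2886 := add_le_add h1 hTsum
    _ ≤ _ := by norm_num

theorem far_landscape (hm : 100 ≤ m)
    (hsep : ∀ j k, j ≠ k → 8 * Real.pi / m ≤ dist (ξ j : Real.Angle) (ξ k : Real.Angle))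
    (U : Submodule ℂ (EuclideanSpace ℂ (Fin m)))
    (hU : U = Submodule.span ℂ (Set.range fun k => steering m (ξ k)))
    {t : ℝ} (ht : ∀ k, 3.9 / m ≤ dist (t : Real.Angle) (ξ k : Real.Angle)) :
    0.539 ≤ landscape U (t : Real.Angle) := by
  have hm' : (100 : ℝ) ≤ m := by exact_mod_cast hm
  rw [landscape_coe]
  have h1 := separated_projection hm hsep U hU (steering m t)
  have h2 : ∑ k, ‖inner ℂ (steering m (ξ k)) (steering m t)‖ ^ 2 ≤ 0.312 := by
    refine le_trans (Finset.sum_le_sum fun k _ => ?_) (far_sum_le hm hsep ht)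
    rw [inner_steering, Complex.norm_real, Real.norm_eq_abs, sq_abs]
    exact dirichlet_sq_le_envelope (by omega)
      (envelope_le_of_dist m (by positivity) (ht k)).1
  linarith

end separated

/-! ### The landscape function near a point of a separated set -/

section separated

variable {m s : ℕ} {ξ : Fin s → ℝ}

theorem near_sum_le (hm : 100 ≤ m)
    (hsep : ∀ j k, j ≠ k → 8 * Real.pi / m ≤ dist (ξ j : Real.Angle) (ξ k : Real.Angle))
    (j : Fin s) {t : ℝ} (ht : m * |t - ξ j| ≤ 3.9) :
    ∑ k with k ≠ j, dirichletDeriv m (t - ξ k) ^ 2 ≤ 0.008 * (m : ℝ) ^ 2 := by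
  have hm' : (100 : ℝ) ≤ m := by exact_mod_cast hm
  have hpi := Real.pi_gt_d2
  have hm2 : 1 / (m : ℝ) ^ 2 ≤ 1 / 10000 := by
    apply one_div_le_one_div_of_le (by norm_num); nlinarith
  have htd : dist (t : Real.Angle) (ξ j : Real.Angle) ≤ 3.9 / m := by
    refine (dist_coe_le _ _).trans ?_
    rw [le_div_iff₀ (by linarith), mul_comm]; exact ht
  -- Moving from `ξ j` to `t` costs `3.9 / m`, at most the fraction `0.1554` of the separation.
  -- Rings can thus be counted around `ξ j`, where ring `0` contains `ξ j` alone.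
  have hsplit : ∀ k, k ≠ j → 0.8446 * dist (ξ k : Real.Angle) (ξ j : Real.Angle)
      ≤ dist (t : Real.Angle) (ξ k : Real.Angle) := by
    intro k hk
    have h1 := hsep k j hk
    have h2 := dist_triangle_left (ξ k : Real.Angle) (ξ j : Real.Angle) (t : Real.Angle)
    have h3 : 3.9 / (m : ℝ) ≤ 0.1554 * (8 * Real.pi / m) := by
      rw [← mul_div_assoc]
      gcongr ?_ / _
      linarith
    linarith
  have hsum := sum_envelope_le hm ξ hsep (ξ j) t (c := 0.8446) (by norm_num)
    (fun k hk => hsplit k ((separated_floor_iff hm hsep j k).1 hk))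
  simp only [separated_floor_iff hm hsep] at hsum
  have hterm : ∀ k ∈ Finset.univ.filter (fun k => k ≠ j),
      dirichletDeriv m (t - ξ k) ^ 2 ≤ (m : ℝ) ^ 2 * (1.009 / 4) * envelope m (t - ξ k) := by
    intro k hk
    have hk' := (Finset.mem_filter.1 hk).2
    have h1 : 21.2 / m ≤ dist (t : Real.Angle) (ξ k : Real.Angle) := by
      refine le_trans ?_ (hsplit k hk')
      have : 21.2 / (m : ℝ) ≤ 0.8446 * (8 * Real.pi / m) := by
        rw [← mul_div_assoc]
        gcongr ?_ / _
        linarith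
      exact this.trans (by gcongr; exact hsep k j hk')
    obtain ⟨h2, h3⟩ := envelope_le_of_dist m (by positivity) h1
    have h4 : (4 / (21.2 / m) ^ 2 + 1) / (m : ℝ) ^ 2 = 4 / 21.2 ^ 2 + 1 / (m : ℝ) ^ 2 := by
      field_simp
    have h5 : envelope m (t - ξ k) ≤ 0.009 := by
      rw [h4] at h3
      refine h3.trans ((add_le_add_right hm2 _).trans (by norm_num))
    have h0 := envelope_nonneg m (t - ξ k)
    refine (dirichletDeriv_sq_le_envelope (by omega) h2).trans ?_
    rw [mul_assoc]
    gcongr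
    linarith only [mul_le_mul_of_nonneg_left h5 h0]
  refine (Finset.sum_le_sum hterm).trans ?_
  rw [← Finset.mul_sum]
  calc _ ≤ (m : ℝ) ^ 2 * (1.009 / 4) * (1 / (48 * 0.8446 ^ 2) + 1 / 400) := by gcongr
    _ = (m : ℝ) ^ 2 * ((1.009 / 4) * (1 / (48 * 0.8446 ^ 2) + 1 / 400)) := by ring
    _ ≤ (m : ℝ) ^ 2 * 0.008 := by gcongr; norm_num
    _ = _ := by ring

/-- The component of `φ(t)` orthogonal to `φ(r)`. -/
noncomputable def residual (m : ℕ) (r t : ℝ) : EuclideanSpace ℂ (Fin m) :=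
  steering m t - dirichlet m (t - r) • steering m r

/-- The component of `φ'(t)` orthogonal to `φ(r)`. -/
noncomputable def residualDeriv (m : ℕ) (r t : ℝ) : EuclideanSpace ℂ (Fin m) :=
  steeringDeriv m t - dirichletDeriv m (t - r) • steering m r

theorem hasDerivAt_residual (m : ℕ) (r t : ℝ) :
    HasDerivAt (residual m r) (residualDeriv m r t) t :=
  (hasDerivAt_steering m t).sub
    (((hasDerivAt_dirichlet m (t - r)).comp_sub_const t r).smul_const (steering m r))

theorem inner_residual (m : ℕ) (p r t : ℝ) :
    inner ℂ (steering m p) (residual m r t)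
      = ((dirichlet m (t - p) - dirichlet m (t - r) * dirichlet m (r - p) : ℝ) : ℂ) := by
  rw [residual, inner_sub_right, ← Complex.coe_smul, inner_smul_right, inner_steering,
    inner_steering]
  push_cast; rfl

theorem inner_residualDeriv (m : ℕ) (p r t : ℝ) :
    inner ℂ (steering m p) (residualDeriv m r t)
      = ((dirichletDeriv m (t - p) - dirichletDeriv m (t - r) * dirichlet m (r - p) : ℝ) : ℂ) := by
  rw [residualDeriv, inner_sub_right, ← Complex.coe_smul, inner_smul_right,
    inner_steering_steeringDeriv, inner_steering]
  push_cast; rfl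

/-- The inner product with `φ (ξ j)` itself vanishes, so only the far nodes contribute, each through
the tail of `D'` or through the leakage of `φ (ξ j)`. -/
theorem norm_projection_residualDeriv_le (hm : 100 ≤ m)
    (hsep : ∀ j k, j ≠ k → 8 * Real.pi / m ≤ dist (ξ j : Real.Angle) (ξ k : Real.Angle))
    (U : Submodule ℂ (EuclideanSpace ℂ (Fin m)))
    (hU : U = Submodule.span ℂ (Set.range fun k => steering m (ξ k)))
    (j : Fin s) {t : ℝ} (ht : m * |t - ξ j| ≤ 3.9) :
    ‖U.starProjection (residualDeriv m (ξ j) t)‖ ≤ Real.sqrt 0.022 * m := by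
  have hm0 : m ≠ 0 := by omega
  have h1 := separated_projection hm hsep U hU (residualDeriv m (ξ j) t)
  obtain ⟨hsin, henv⟩ := separated_envelope hm hsep
  have hD' := abs_dirichletDeriv_le hm ht
  have hDsq : dirichletDeriv m (t - ξ j) ^ 2 ≤ (0.222 * m) ^ 2 := by
    rw [← sq_abs]; gcongr
  -- Weighted Young inequality `(x - y)² ≤ (1 + 3/8) x² + (1 + 8/3) y²`.
  have hterm : ∀ k, k ≠ j → ‖inner ℂ (steering m (ξ k)) (residualDeriv m (ξ j) t)‖ ^ 2
      ≤ 1.375 * dirichletDeriv m (t - ξ k) ^ 2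
        + 11 / 3 * (0.222 * m) ^ 2 * envelope m (ξ j - ξ k) := by
    intro k hk
    rw [inner_residualDeriv, Complex.norm_real, Real.norm_eq_abs, sq_abs]
    have h2 := dirichlet_sq_le_envelope hm0 (hsin j k hk)
    have h3 := mul_le_mul hDsq h2 (sq_nonneg _) (sq_nonneg _)
    nlinarith only [h3, sq_nonneg (3 * dirichletDeriv m (t - ξ k)
      + 8 * (dirichletDeriv m (t - ξ j) * dirichlet m (ξ j - ξ k)))]
  have hsum : ∑ k, ‖inner ℂ (steering m (ξ k)) (residualDeriv m (ξ j) t)‖ ^ 2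
      ≤ 0.01522 * (m : ℝ) ^ 2 := by
    rw [← Finset.add_sum_erase _ _ (Finset.mem_univ j), ← Finset.filter_ne', inner_residualDeriv,
      sub_self, dirichlet_zero hm0, mul_one, sub_self]
    have h2 := Finset.sum_le_sum fun k (hk : k ∈ Finset.univ.filter (fun k => k ≠ j)) =>
      hterm k (Finset.mem_filter.1 hk).2
    rw [Finset.sum_add_distrib, ← Finset.mul_sum, ← Finset.mul_sum] at h2
    have h3 := near_sum_le hm hsep j ht
    have h4 := mul_le_mul_of_nonneg_left (henv j)
      (show 0 ≤ 11 / 3 * (0.222 * (m : ℝ)) ^ 2 by positivity)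
    simp only [Complex.ofReal_zero, norm_zero]
    nlinarith only [h2, h3, h4]
  have h2 : ‖U.starProjection (residualDeriv m (ξ j) t)‖ ^ 2 ≤ (Real.sqrt 0.022 * m) ^ 2 := by
    rw [mul_pow, Real.sq_sqrt (by norm_num)]
    nlinarith only [h1, hsum, sq_nonneg (m : ℝ)]
  exact abs_le_of_sq_le_sq' h2 (by positivity) |>.2

/-- Mean value inequality from `ξ j`, where the residual vanishes. The factor `|t - ξ j|` gained
here is what makes the interference linear. -/
theorem norm_projection_residual_le (hm : 100 ≤ m)
    (hsep : ∀ j k, j ≠ k → 8 * Real.pi / m ≤ dist (ξ j : Real.Angle) (ξ k : Real.Angle))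
    (U : Submodule ℂ (EuclideanSpace ℂ (Fin m)))
    (hU : U = Submodule.span ℂ (Set.range fun k => steering m (ξ k)))
    (j : Fin s) {t : ℝ} (ht : m * |t - ξ j| ≤ 3.9) :
    ‖U.starProjection (residual m (ξ j) t)‖ ≤ Real.sqrt 0.022 * m * |t - ξ j| := by
  have hm0 : (0 : ℝ) < m := by
    have : (100 : ℝ) ≤ m := by exact_mod_cast hm
    linarith
  have hmem : ∀ r ∈ Set.Icc (ξ j - 3.9 / m) (ξ j + 3.9 / m), m * |r - ξ j| ≤ 3.9 := by
    intro r hr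
    rw [mul_comm, ← le_div_iff₀ hm0, abs_le]
    constructor <;> linarith [hr.1, hr.2]
  have ht' : t ∈ Set.Icc (ξ j - 3.9 / m) (ξ j + 3.9 / m) := by
    rw [mul_comm, ← le_div_iff₀ hm0, abs_le] at ht
    constructor <;> linarith [ht.1, ht.2]
  have hj' : ξ j ∈ Set.Icc (ξ j - 3.9 / m) (ξ j + 3.9 / m) := by
    have : 0 < 3.9 / (m : ℝ) := by positivity
    constructor <;> linarith
  have h := Convex.norm_image_sub_le_of_norm_hasDerivWithin_le (𝕜 := ℝ)
    (f := fun r => U.starProjection (residual m (ξ j) r))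
    (f' := fun r => U.starProjection (residualDeriv m (ξ j) r))
    (fun r _ => ((U.starProjection.restrictScalars ℝ).hasFDerivAt.comp_hasDerivAt r
      (hasDerivAt_residual m (ξ j) r)).hasDerivWithinAt)
    (fun r hr => norm_projection_residualDeriv_le hm hsep U hU j (hmem r hr))
    (convex_Icc _ _) hj' ht'
  have h0 : residual m (ξ j) (ξ j) = 0 := by
    rw [residual, sub_self, dirichlet_zero (by omega), one_smul, sub_self]
  simpa only [h0, map_zero, sub_zero, Real.norm_eq_abs] using h

/-- Near `ξ j`, the derivative of the landscape function is that for the single point `ξ j`, up to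
an interference term that is linear in the distance. -/
theorem near_landscapeDeriv (hm : 100 ≤ m)
    (hsep : ∀ j k, j ≠ k → 8 * Real.pi / m ≤ dist (ξ j : Real.Angle) (ξ k : Real.Angle))
    (U : Submodule ℂ (EuclideanSpace ℂ (Fin m)))
    (hU : U = Submodule.span ℂ (Set.range fun k => steering m (ξ k)))
    (j : Fin s) {t : ℝ} (ht : m * |t - ξ j| ≤ 3.9) :
    |landscapeDeriv U t + 2 * dirichlet m (t - ξ j) * dirichletDeriv m (t - ξ j)|
      ≤ 0.044 * ((m : ℝ) ^ 2 * |t - ξ j|) := by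
  have hm0 : m ≠ 0 := by omega
  set φ := steering m (ξ j) with hφ
  set a := residual m (ξ j) t with ha
  set b := residualDeriv m (ξ j) t with hb
  set D := dirichlet m (t - ξ j) with hD
  set D' := dirichletDeriv m (t - ξ j) with hD'
  have hφU : U.starProjection φ = φ := by
    rw [Submodule.starProjection_eq_self_iff, hU]
    exact Submodule.subset_span ⟨j, rfl⟩
  have e1 : steering m t = a + (D : ℂ) • φ := by
    rw [ha, residual, Complex.coe_smul]; simp [hD, hφ]
  have e2 : steeringDeriv m t = b + (D' : ℂ) • φ := by
    rw [hb, residualDeriv, Complex.coe_smul]; simp [hD', hφ]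
  have h1 : inner ℂ φ (U.starProjection a) = 0 := by
    rw [← Submodule.inner_starProjection_left_eq_right, hφU, hφ, ha, inner_residual, sub_self,
      dirichlet_zero hm0]
    simp
  have h2 : inner ℂ (steeringDeriv m t) φ = (D' : ℂ) := by
    rw [← inner_conj_symm, hφ, inner_steering_steeringDeriv, Complex.conj_ofReal]
  have h3 : inner ℂ b (U.starProjection a)
      = inner ℂ (U.starProjection b) (U.starProjection a) := by
    have h4 : U.starProjection (U.starProjection a) = U.starProjection a :=
      Submodule.starProjection_eq_self_iff.2 (Submodule.starProjection_apply_mem U a)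
    rw [Submodule.inner_starProjection_left_eq_right, h4]
  -- The cross terms vanish or join `D D'`, because `U` fixes `φ (ξ j)` and the residual is
  -- orthogonal to it.
  have h4 : landscapeDeriv U t + 2 * D * D'
      = -(2 * (inner ℂ (U.starProjection b) (U.starProjection a)).re) := by
    rw [landscapeDeriv, e1, map_add, map_smul, hφU, inner_add_right, inner_smul_right, h2, e2,
      inner_add_left, inner_smul_left, h1, h3, mul_zero, add_zero, Complex.add_re,
      ← Complex.ofReal_mul, Complex.ofReal_re]
    ring
  rw [h4, abs_neg, abs_mul, abs_two]
  have h5 : |(inner ℂ (U.starProjection b) (U.starProjection a)).re|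
      ≤ (Real.sqrt 0.022 * m) * (Real.sqrt 0.022 * m * |t - ξ j|) :=
    (Complex.abs_re_le_norm _).trans ((norm_inner_le_norm _ _).trans
      (mul_le_mul (norm_projection_residualDeriv_le hm hsep U hU j ht)
        (norm_projection_residual_le hm hsep U hU j ht) (norm_nonneg _) (by positivity)))
  have h6 : Real.sqrt 0.022 * Real.sqrt 0.022 = 0.022 := Real.mul_self_sqrt (by norm_num)
  have h7 : (Real.sqrt 0.022 * m) * (Real.sqrt 0.022 * m * |t - ξ j|)
      = Real.sqrt 0.022 * Real.sqrt 0.022 * ((m : ℝ) ^ 2 * |t - ξ j|) := by ring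
  rw [h7, h6] at h5
  linarith

/-- Projecting onto `φ (ξ j)` alone already captures norm `D ≥ 1 - 0.49 / 24`. -/
theorem near_landscape_le (hm : 100 ≤ m) (U : Submodule ℂ (EuclideanSpace ℂ (Fin m)))
    (hU : U = Submodule.span ℂ (Set.range fun k => steering m (ξ k)))
    (j : Fin s) {t : ℝ} (ht : m * |t - ξ j| ≤ 0.7) :
    landscape U (t : Real.Angle) ≤ 0.05 := by
  have hm0 : m ≠ 0 := by omega
  have hφU : U.starProjection (steering m (ξ j)) = steering m (ξ j) := by
    rw [Submodule.starProjection_eq_self_iff, hU]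
    exact Submodule.subset_span ⟨j, rfl⟩
  have h1 : inner ℂ (steering m (ξ j)) (U.starProjection (steering m t))
      = (dirichlet m (t - ξ j) : ℂ) := by
    rw [← Submodule.inner_starProjection_left_eq_right, hφU, inner_steering]
  have h2 := norm_inner_le_norm (𝕜 := ℂ) (steering m (ξ j)) (U.starProjection (steering m t))
  rw [h1, norm_steering hm0, one_mul, Complex.norm_real, Real.norm_eq_abs] at h2
  have h3 := one_sub_le_dirichlet hm0 (t - ξ j)
  have h4 : (m : ℝ) ^ 2 * (t - ξ j) ^ 2 ≤ 0.49 := by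
    calc _ = (m * |t - ξ j|) ^ 2 := by rw [mul_pow, sq_abs]
      _ ≤ 0.7 ^ 2 := by gcongr
      _ = 0.49 := by norm_num
  have h5 : 0.979 ≤ ‖U.starProjection (steering m t)‖ :=
    le_trans (by linarith) ((le_abs_self _).trans h2)
  rw [landscape_coe]
  nlinarith

/-- Near `ξ j`, the derivative of a perturbed landscape function is comparable to
`m ^ 2 (t - ξ j)`. -/
theorem near_perturbed (hm : 100 ≤ m)
    (hsep : ∀ j k, j ≠ k → 8 * Real.pi / m ≤ dist (ξ j : Real.Angle) (ξ k : Real.Angle))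
    (U W : Submodule ℂ (EuclideanSpace ℂ (Fin m)))
    (hU : U = Submodule.span ℂ (Set.range fun k => steering m (ξ k)))
    (j : Fin s) {t : ℝ} (ht : m * |t - ξ j| ≤ 3.9) :
    ∃ ρ : ℝ, 0.0087 ≤ ρ ∧ ρ ≤ 0.211 ∧ (m * |t - ξ j| ≤ 1.5 → 0.086 ≤ ρ) ∧
      |landscapeDeriv W t - ρ * (m ^ 2 * (t - ξ j))| ≤ 0.57736 * sinTheta U W * m := by
  have hpert := abs_landscapeDeriv_sub_le (by omega : m ≠ 0) U W t
  have hnear := near_landscapeDeriv hm hsep U hU j ht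
  have hm0 : (0 : ℝ) < m := by
    have : (100 : ℝ) ≤ m := by exact_mod_cast hm
    linarith
  -- The bounds on `ρ` are `0.0527 - 0.044`, `1 / 6 + 0.044` and `0.13 - 0.044`: the main lobe less
  -- or plus the interference.
  suffices h : ∃ ρ : ℝ, 0.0087 ≤ ρ ∧ ρ ≤ 0.211 ∧ (m * |t - ξ j| ≤ 1.5 → 0.086 ≤ ρ) ∧
      landscapeDeriv U t = ρ * (m ^ 2 * (t - ξ j)) by
    obtain ⟨ρ, h1, h2, h3, h4⟩ := h
    exact ⟨ρ, h1, h2, h3, by rwa [← h4]⟩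
  set τ := t - ξ j with hτ
  rcases lt_trichotomy τ 0 with h0 | h0 | h0
  · rw [abs_of_neg h0] at hnear ht ⊢
    obtain ⟨g1, g2, g3⟩ := mainLobe_deriv hm (t := -τ) (by linarith) ht
    rw [dirichlet_neg, dirichletDeriv_neg] at g1 g2 g3
    obtain ⟨n1, n2⟩ := abs_le.1 hnear
    have hp : 0 < (m : ℝ) ^ 2 * (-τ) := mul_pos (by positivity) (by linarith)
    refine ⟨-landscapeDeriv U t / (m ^ 2 * (-τ)), ?_, ?_, ?_, ?_⟩
    · rw [le_div_iff₀ hp]; linarith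
    · rw [div_le_iff₀ hp]; linarith
    · intro h; rw [le_div_iff₀ hp]; linarith [g2 h]
    · have : τ ≠ 0 := h0.ne
      field_simp
  · rw [h0, abs_zero, mul_zero, mul_zero] at hnear
    have hz : dirichletDeriv m 0 = 0 := by simp [dirichletDeriv]
    rw [hz, mul_zero, add_zero] at hnear
    refine ⟨0.1, by norm_num, by norm_num, fun _ => by norm_num, ?_⟩
    rw [h0, abs_nonpos_iff.1 hnear]; ring
  · rw [abs_of_pos h0] at hnear ht ⊢
    obtain ⟨g1, g2, g3⟩ := mainLobe_deriv hm h0.le ht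
    obtain ⟨n1, n2⟩ := abs_le.1 hnear
    have hp : 0 < (m : ℝ) ^ 2 * τ := by positivity
    refine ⟨landscapeDeriv U t / (m ^ 2 * τ), ?_, ?_, ?_, ?_⟩
    · rw [le_div_iff₀ hp]; linarith
    · rw [div_le_iff₀ hp]; linarith
    · intro h; rw [le_div_iff₀ hp]; linarith [g2 h]
    · field_simp

end separated

/-! ### Gradient descent -/

/-- Convexity of the squared norm gives `‖P φ(r)‖² ≥ 2 Re ⟨φ(r), p⟩ - ‖p‖²` with `p = P φ(t)`. Only
`φ(r)` is then expanded, so no second derivative of the landscape function is needed. -/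
theorem landscape_taylor_le {m : ℕ} (hm : m ≠ 0) (W : Submodule ℂ (EuclideanSpace ℂ (Fin m)))
    (t r : ℝ) : landscape W (r : Real.Angle) ≤ landscape W (t : Real.Angle)
      + landscapeDeriv W t * (r - t) + 0.1444 * ((m : ℝ) ^ 2 * (r - t) ^ 2) := by
  set p := W.starProjection (steering m t) with hp
  set R := steering m r - steering m t - ((r - t : ℝ) : ℂ) • steeringDeriv m t with hR
  have hpp : W.starProjection p = p :=
    Submodule.starProjection_eq_self_iff.2 (Submodule.starProjection_apply_mem W _)
  have h1 : ‖W.starProjection (steering m r) - p‖ ^ 2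
      = ‖W.starProjection (steering m r)‖ ^ 2 - 2 * (inner ℂ (steering m r) p).re + ‖p‖ ^ 2 := by
    rw [@norm_sub_sq ℂ, Submodule.inner_starProjection_left_eq_right, hpp]
    rfl
  have h2 : steering m r = steering m t + ((r - t : ℝ) : ℂ) • steeringDeriv m t + R := by
    rw [hR]; abel
  have h3 : (inner ℂ (steering m r) p).re = ‖p‖ ^ 2
      + (r - t) * (inner ℂ (steeringDeriv m t) p).re + (inner ℂ R p).re := by
    rw [h2, inner_add_left, inner_add_left, inner_smul_left, Complex.conj_ofReal,
      Complex.add_re, Complex.add_re, Complex.re_ofReal_mul, hp, norm_sq_starProjection]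
  have h4 : ‖R‖ ≤ 0.0722 * ((m : ℝ) ^ 2 * (r - t) ^ 2) := by
    refine abs_le_of_sq_le_sq' ?_ (by positivity) |>.2
    refine (norm_steering_taylor_sq_le hm t r).trans ?_
    have : 0 ≤ (m : ℝ) ^ 4 * (r - t) ^ 4 := by positivity
    nlinarith only [this]
  have h5 : ‖p‖ ≤ 1 := by
    rw [← norm_steering hm t]; exact W.norm_starProjection_apply_le _
  have h6 : |(inner ℂ R p).re| ≤ 0.0722 * ((m : ℝ) ^ 2 * (r - t) ^ 2) * 1 :=
    (Complex.abs_re_le_norm _).trans ((norm_inner_le_norm _ _).trans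
      (mul_le_mul h4 h5 (norm_nonneg _) (by positivity)))
  have h7 := neg_le_of_abs_le h6
  have h8 := sq_nonneg ‖W.starProjection (steering m r) - p‖
  rw [h1, h3] at h8
  rw [landscape_coe, landscape_coe, landscapeDeriv, ← hp]
  linarith

theorem gradIter_succ (q : Real.Angle → ℝ) (h : ℝ) (t₀ : Real.Angle) (k : ℕ) :
    gradIter q h t₀ (k + 1) = gradIter q h t₀ k
      - ((h * torusDeriv q (gradIter q h t₀ k) : ℝ) : Real.Angle) := by
  simp only [gradIter, Function.iterate_succ_apply']

/-- The step `6 / m²` gains `6` and loses `36 * 0.1444 < 5.2` times the squared scaled gradient. -/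
theorem landscape_gradIter_succ_le {m : ℕ} (hm : m ≠ 0)
    (W : Submodule ℂ (EuclideanSpace ℂ (Fin m))) (t₀ : Real.Angle) (k : ℕ) :
    landscape W (gradIter (landscape W) (6 / (m : ℝ) ^ 2) t₀ (k + 1))
      ≤ landscape W (gradIter (landscape W) (6 / (m : ℝ) ^ 2) t₀ k)
        - 0.8 * (torusDeriv (landscape W)
          (gradIter (landscape W) (6 / (m : ℝ) ^ 2) t₀ k) / m) ^ 2 := by
  have hm' : (m : ℝ) ≠ 0 := by exact_mod_cast hm
  rw [gradIter_succ]
  set t := gradIter (landscape W) (6 / (m : ℝ) ^ 2) t₀ k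
  obtain ⟨r, hr⟩ : ∃ r : ℝ, (r : Real.Angle) = t := ⟨t.toReal, t.coe_toReal⟩
  rw [← hr, torusDeriv_landscape, ← Real.Angle.coe_sub]
  refine (landscape_taylor_le hm W r _).trans ?_
  set g := landscapeDeriv W r
  have h1 : g * (r - 6 / (m : ℝ) ^ 2 * g - r) = -6 * (g / m) ^ 2 := by field_simp; ring
  have h2 : (m : ℝ) ^ 2 * (r - 6 / (m : ℝ) ^ 2 * g - r) ^ 2 = 36 * (g / m) ^ 2 := by
    field_simp; ring
  rw [h1, h2]
  nlinarith only [sq_nonneg (g / m)]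

/-- Gradient descent on a landscape function meets every gradient tolerance. -/
theorem exists_gradIter_deriv_le {m : ℕ} (hm : m ≠ 0)
    (W : Submodule ℂ (EuclideanSpace ℂ (Fin m))) (t₀ : Real.Angle) {ε : ℝ} (hε : 0 < ε) (N : ℕ) :
    ∃ k : ℕ, N ≤ k ∧ |torusDeriv (landscape W)
      (gradIter (landscape W) (6 / (m : ℝ) ^ 2) t₀ k)| ≤ ε * m := by
  by_contra! hcon
  have hm' : (0 : ℝ) < m := by positivity
  set t : ℕ → Real.Angle := gradIter (landscape W) (6 / (m : ℝ) ^ 2) t₀ with ht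
  have hstep : ∀ n : ℕ, landscape W (t (N + n)) ≤ landscape W (t N) - n * (0.8 * ε ^ 2) := by
    intro n
    induction n with
    | zero => simp
    | succ n ih =>
      have h1 := landscape_gradIter_succ_le hm W t₀ (N + n)
      have h2 := hcon (N + n) (by omega)
      have h3 : ε ^ 2 ≤ (torusDeriv (landscape W) (t (N + n)) / m) ^ 2 := by
        rw [← sq_abs (_ / _), abs_div, abs_of_pos hm']
        gcongr
        rw [le_div_iff₀ hm']; exact h2.le
      rw [← add_assoc]
      push_cast
      linarith
  obtain ⟨n, hn⟩ := exists_nat_gt (landscape W (t N) / (0.8 * ε ^ 2))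
  rw [div_lt_iff₀ (by positivity)] at hn
  have := landscape_nonneg hm W (t (N + n))
  linarith [hstep n]

section separated

variable {m s : ℕ} {ξ : Fin s → ℝ}

/-- A step multiplies `τ` by `1 - 6 ρ`, of modulus at most `1 - 6 * 0.0087`, and the perturbation
adds at most `6 * 0.00578` in units of `1 / m`. -/
theorem gradient_step_le (hm : 100 ≤ m)
    (hsep : ∀ j k, j ≠ k → 8 * Real.pi / m ≤ dist (ξ j : Real.Angle) (ξ k : Real.Angle))
    (U W : Submodule ℂ (EuclideanSpace ℂ (Fin m)))
    (hU : U = Submodule.span ℂ (Set.range fun k => steering m (ξ k)))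
    (hϑ : sinTheta U W ≤ 0.01) (j : Fin s) {τ : ℝ} (hτ : m * |τ| ≤ 3.9) :
    m * |τ - 6 / (m : ℝ) ^ 2 * landscapeDeriv W (ξ j + τ)| ≤ 0.9478 * (m * |τ|) + 0.0347 := by
  have hm0 : (0 : ℝ) < m := by
    have : (100 : ℝ) ≤ m := by exact_mod_cast hm
    linarith
  have e : ξ j + τ - ξ j = τ := by ring
  obtain ⟨ρ, h1, h2, -, h4⟩ := near_perturbed hm hsep U W hU j (t := ξ j + τ) (by rwa [e])
  rw [e] at h4
  set g := landscapeDeriv W (ξ j + τ)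
  have h5 : m * (τ - 6 / (m : ℝ) ^ 2 * g)
      = (1 - 6 * ρ) * (m * τ) - 6 * ((g - ρ * (m ^ 2 * τ)) / m) := by
    field_simp; ring
  have h6 : |(g - ρ * (m ^ 2 * τ)) / m| ≤ 0.00578 := by
    rw [abs_div, abs_of_pos hm0, div_le_iff₀ hm0]
    refine h4.trans ?_
    gcongr
    linarith
  have h7 : |1 - 6 * ρ| ≤ 0.9478 := by rw [abs_le]; constructor <;> linarith
  calc (m : ℝ) * |τ - 6 / (m : ℝ) ^ 2 * g| = |(m : ℝ) * (τ - 6 / (m : ℝ) ^ 2 * g)| := by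
        rw [abs_mul, abs_of_pos hm0]
    _ ≤ |(1 - 6 * ρ) * (m * τ)| + |6 * ((g - ρ * (m ^ 2 * τ)) / m)| := by
        rw [h5]; exact abs_sub _ _
    _ = |1 - 6 * ρ| * (m * |τ|) + 6 * |(g - ρ * (m ^ 2 * τ)) / m| := by
        rw [abs_mul, abs_mul, abs_mul, abs_of_pos hm0, abs_of_pos (show (0 : ℝ) < 6 by norm_num)]
    _ ≤ 0.9478 * (m * |τ|) + 6 * 0.00578 := by gcongr
    _ ≤ _ := by linarith

/-- The affine bound `y ↦ 0.9478 y + 0.0347` maps `[0, 3.9]` into itself and has its fixed point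
just below `0.665`. -/
theorem gradIter_mem (hm : 100 ≤ m)
    (hsep : ∀ j k, j ≠ k → 8 * Real.pi / m ≤ dist (ξ j : Real.Angle) (ξ k : Real.Angle))
    (U W : Submodule ℂ (EuclideanSpace ℂ (Fin m)))
    (hU : U = Submodule.span ℂ (Set.range fun k => steering m (ξ k)))
    (hϑ : sinTheta U W ≤ 0.01) (j : Fin s) {τ₀ : ℝ} (hτ : m * |τ₀| ≤ 3.9) (k : ℕ) :
    ∃ τ : ℝ, gradIter (landscape W) (6 / (m : ℝ) ^ 2) ((ξ j + τ₀ : ℝ) : Real.Angle) k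
        = ((ξ j + τ : ℝ) : Real.Angle) ∧
      m * |τ| ≤ 3.9 ∧ m * |τ| ≤ 3.9 * 0.9478 ^ k + 0.665 := by
  induction k with
  | zero => exact ⟨τ₀, rfl, hτ, by norm_num at hτ ⊢; linarith⟩
  | succ k ih =>
    obtain ⟨τ, h1, h2, h3⟩ := ih
    have h4 := gradient_step_le hm hsep U W hU hϑ j h2
    refine ⟨τ - 6 / (m : ℝ) ^ 2 * landscapeDeriv W (ξ j + τ), ?_, by linarith, ?_⟩
    · rw [gradIter_succ, h1, torusDeriv_landscape, ← Real.Angle.coe_sub]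
      congr 1; ring
    · rw [pow_succ (0.9478 : ℝ)]; linarith

theorem gradIter_error_le (hm : 100 ≤ m)
    (hsep : ∀ j k, j ≠ k → 8 * Real.pi / m ≤ dist (ξ j : Real.Angle) (ξ k : Real.Angle))
    (U W : Submodule ℂ (EuclideanSpace ℂ (Fin m)))
    (hU : U = Submodule.span ℂ (Set.range fun k => steering m (ξ k)))
    (hϑ : sinTheta U W ≤ 0.01) (j : Fin s) {t₀ : Real.Angle}
    (ht₀ : dist t₀ (ξ j : Real.Angle) ≤ 3.9 / m) {k : ℕ} (hk : 31 ≤ k) {ε : ℝ} (hε : 0 < ε)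
    (hgrad : |torusDeriv (landscape W) (gradIter (landscape W) (6 / (m : ℝ) ^ 2) t₀ k)| ≤ ε * m) :
    dist (ξ j : Real.Angle) (gradIter (landscape W) (6 / (m : ℝ) ^ 2) t₀ k)
      ≤ 7 * sinTheta U W / m + 37 * ε / m := by
  have hm0 : (0 : ℝ) < m := by
    have : (100 : ℝ) ≤ m := by exact_mod_cast hm
    linarith
  have hϑ0 : 0 ≤ sinTheta U W := norm_nonneg _
  have h0 : t₀ = ((ξ j + (t₀ - (ξ j : Real.Angle)).toReal : ℝ) : Real.Angle) := by
    rw [Real.Angle.coe_add, Real.Angle.coe_toReal]; abel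
  rw [dist_eq_abs_toReal, le_div_iff₀ hm0, mul_comm] at ht₀
  obtain ⟨τ, h1, h2, h3⟩ := gradIter_mem hm hsep U W hU hϑ j ht₀ k
  rw [← h0] at h1
  have h4 : m * |τ| ≤ 1.5 := by
    refine h3.trans ?_
    have : (0.9478 : ℝ) ^ k ≤ 0.9478 ^ 31 :=
      pow_le_pow_of_le_one (by norm_num) (by norm_num) hk
    calc _ ≤ 3.9 * (0.9478 : ℝ) ^ 31 + 0.665 := by gcongr
      _ ≤ _ := by norm_num
  have e : ξ j + τ - ξ j = τ := by ring
  obtain ⟨ρ, -, -, h5, h6⟩ := near_perturbed hm hsep U W hU j (t := ξ j + τ) (by rwa [e])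
  rw [e] at h5 h6
  rw [h1, torusDeriv_landscape] at hgrad
  have h7 : ρ * (m * (m * |τ|)) ≤ (ε + 0.57736 * sinTheta U W) * m := by
    calc ρ * (m * (m * |τ|)) = |ρ * (m ^ 2 * τ)| := by
          rw [abs_mul, abs_mul, abs_of_nonneg (by linarith [h5 h4] : 0 ≤ ρ),
            abs_of_pos (by positivity : (0 : ℝ) < m ^ 2)]
          ring
      _ = |landscapeDeriv W (ξ j + τ) - (landscapeDeriv W (ξ j + τ) - ρ * (m ^ 2 * τ))| := by
          congr 1; ring
      _ ≤ _ := abs_sub _ _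
      _ ≤ ε * m + 0.57736 * sinTheta U W * m := add_le_add hgrad h6
      _ = _ := by ring
  have h8 : ρ * (m * |τ|) ≤ ε + 0.57736 * sinTheta U W := by
    refine le_of_mul_le_mul_right ?_ hm0
    linarith
  have h9 : 0.086 * (m * |τ|) ≤ ρ * (m * |τ|) := by gcongr; exact h5 h4
  rw [h1]
  refine (dist_coe_le _ _).trans ?_
  rw [sub_add_cancel_left, abs_neg, ← add_div, le_div_iff₀ hm0, mul_comm]
  linarith

/-! ### Clusters of accepted points -/

theorem exists_mesh_dist_le {G : Finset Real.Angle} {δ : ℝ} (hδ : 0 ≤ δ)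
    (hG : mesh G ≤ ENNReal.ofReal δ) (p : Real.Angle) : ∃ g ∈ G, dist p g ≤ δ := by
  have h1 : Metric.infEDist p (G : Set Real.Angle) ≤ ENNReal.ofReal δ :=
    (le_iSup (fun t => Metric.infEDist t (G : Set Real.Angle)) p).trans hG
  have hne : (G : Set Real.Angle).Nonempty := by
    rw [Set.nonempty_iff_ne_empty]
    intro h
    rw [h, Metric.infEDist_empty, top_le_iff] at h1
    exact ENNReal.ofReal_ne_top h1
  obtain ⟨g, hg, he⟩ := G.finite_toSet.isCompact.exists_infEDist_eq_edist hne p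
  rw [he, edist_dist, ENNReal.ofReal_le_ofReal_iff hδ] at h1
  exact ⟨g, hg, h1⟩

/-- The accepted points near `ξ j`. -/
def nearAccepted {m : ℕ} (W : Submodule ℂ (EuclideanSpace ℂ (Fin m))) (G : Finset Real.Angle)
    (r : ℝ) : Set Real.Angle :=
  {u | u ∈ accepted (landscape W) G 0.529 ∧ dist u (r : Real.Angle) < 3.9 / m}

theorem exists_near_of_accepted (hm : 100 ≤ m)
    (hsep : ∀ j k, j ≠ k → 8 * Real.pi / m ≤ dist (ξ j : Real.Angle) (ξ k : Real.Angle))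
    (U W : Submodule ℂ (EuclideanSpace ℂ (Fin m)))
    (hU : U = Submodule.span ℂ (Set.range fun k => steering m (ξ k)))
    (hϑ : sinTheta U W ≤ 0.01) {G : Finset Real.Angle} {u : Real.Angle}
    (hu : u ∈ accepted (landscape W) G 0.529) : ∃ j, u ∈ nearAccepted W G (ξ j) := by
  by_contra! h
  have h1 : ∀ k, 3.9 / m ≤ dist (u.toReal : Real.Angle) (ξ k : Real.Angle) := by
    intro k
    rw [Real.Angle.coe_toReal]
    exact not_lt.1 fun h2 => h k ⟨hu, h2⟩
  have h2 := far_landscape hm hsep U hU h1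
  have h3 := (abs_le.1 (abs_landscape_sub_le (by omega : m ≠ 0) U W u.toReal)).1
  rw [Real.Angle.coe_toReal] at h2 h3
  linarith [hu.2]

theorem landscape_lt_of_near (hm : 100 ≤ m) (U W : Submodule ℂ (EuclideanSpace ℂ (Fin m)))
    (hU : U = Submodule.span ℂ (Set.range fun k => steering m (ξ k)))
    (hϑ : sinTheta U W ≤ 0.01) (j : Fin s) {t : ℝ} (ht : m * |t - ξ j| ≤ 0.7) :
    landscape W (t : Real.Angle) < 0.529 := by
  have h2 := near_landscape_le hm U hU j ht
  have h3 := (abs_le.1 (abs_landscape_sub_le (by omega : m ≠ 0) U W t)).2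
  linarith

theorem nearAccepted_nonempty (hm : 100 ≤ m) (U W : Submodule ℂ (EuclideanSpace ℂ (Fin m)))
    (hU : U = Submodule.span ℂ (Set.range fun k => steering m (ξ k)))
    (hϑ : sinTheta U W ≤ 0.01) {G : Finset Real.Angle}
    (hG : mesh G ≤ ENNReal.ofReal (1 / (2 * (m : ℝ)))) (j : Fin s) :
    (nearAccepted W G (ξ j)).Nonempty := by
  have hm0 : (0 : ℝ) < m := by
    have : (100 : ℝ) ≤ m := by exact_mod_cast hm
    linarith
  obtain ⟨g, hg, hd⟩ := exists_mesh_dist_le (by positivity) hG (ξ j : Real.Angle)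
  rw [dist_comm] at hd
  have h0 : g = ((ξ j + (g - (ξ j : Real.Angle)).toReal : ℝ) : Real.Angle) := by
    rw [Real.Angle.coe_add, Real.Angle.coe_toReal]; abel
  refine ⟨g, ⟨hg, ?_⟩, hd.trans_lt ?_⟩
  · rw [h0]
    refine landscape_lt_of_near hm U W hU hϑ j ?_
    rw [add_sub_cancel_left, ← dist_eq_abs_toReal]
    calc m * dist g (ξ j : Real.Angle) ≤ m * (1 / (2 * (m : ℝ))) := by gcongr
      _ = 0.5 := by field_simp; norm_num
      _ ≤ 0.7 := by norm_num
  · rw [div_lt_div_iff₀ (by positivity) hm0]; linarith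

/-- From `0.7 / m` on, the slope `0.0087 * 0.7 * m` exceeds the perturbation `0.00578 * m`. -/
theorem landscape_monotoneOn (hm : 100 ≤ m)
    (hsep : ∀ j k, j ≠ k → 8 * Real.pi / m ≤ dist (ξ j : Real.Angle) (ξ k : Real.Angle))
    (U W : Submodule ℂ (EuclideanSpace ℂ (Fin m)))
    (hU : U = Submodule.span ℂ (Set.range fun k => steering m (ξ k)))
    (hϑ : sinTheta U W ≤ 0.01) (j : Fin s) :
    MonotoneOn (fun t : ℝ => landscape W (t : Real.Angle))
      (Set.Icc (ξ j + 0.7 / m) (ξ j + 3.9 / m)) ∧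
    AntitoneOn (fun t : ℝ => landscape W (t : Real.Angle))
      (Set.Icc (ξ j - 3.9 / m) (ξ j - 0.7 / m)) := by
  have hm0 : (0 : ℝ) < m := by
    have : (100 : ℝ) ≤ m := by exact_mod_cast hm
    linarith
  have key : ∀ t, 0.7 ≤ m * |t - ξ j| → m * |t - ξ j| ≤ 3.9 →
      ∃ e : ℝ, |e| ≤ 0.00578 * m ∧ ∃ ρ : ℝ, 0.0087 ≤ ρ ∧
        landscapeDeriv W t = ρ * m * (m * (t - ξ j)) + e := by
    intro t h1 h2
    obtain ⟨ρ, h3, -, -, h4⟩ := near_perturbed hm hsep U W hU j h2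
    refine ⟨_, h4.trans ?_, ρ, h3, by ring⟩
    gcongr
    linarith
  constructor
  · refine monotoneOn_of_hasDerivWithinAt_nonneg (convex_Icc _ _)
      (fun t _ => (hasDerivAt_landscape W t).continuousAt.continuousWithinAt)
      (fun t _ => (hasDerivAt_landscape W t).hasDerivWithinAt) fun t ht => ?_
    rw [interior_Icc] at ht
    have h0 : 0.7 / m ≤ t - ξ j := by linarith [ht.1]
    have h1 : t - ξ j ≤ 3.9 / m := by linarith [ht.2]
    rw [div_le_iff₀ hm0, mul_comm] at h0
    rw [le_div_iff₀ hm0, mul_comm] at h1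
    have h2 : 0 ≤ t - ξ j := by
      by_contra h; push Not at h; nlinarith
    obtain ⟨e, he, ρ, h3, h4⟩ := key t (by rwa [abs_of_nonneg h2]) (by rwa [abs_of_nonneg h2])
    rw [h4]
    have h5 : 0.0087 * m * 0.7 ≤ ρ * m * (m * (t - ξ j)) := by gcongr
    linarith [neg_le_of_abs_le he]
  · refine antitoneOn_of_hasDerivWithinAt_nonpos (convex_Icc _ _)
      (fun t _ => (hasDerivAt_landscape W t).continuousAt.continuousWithinAt)
      (fun t _ => (hasDerivAt_landscape W t).hasDerivWithinAt) fun t ht => ?_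
    rw [interior_Icc] at ht
    have h0 : 0.7 / m ≤ -(t - ξ j) := by linarith [ht.2]
    have h1 : -(t - ξ j) ≤ 3.9 / m := by linarith [ht.1]
    rw [div_le_iff₀ hm0, mul_comm] at h0
    rw [le_div_iff₀ hm0, mul_comm] at h1
    have h2 : t - ξ j ≤ 0 := by
      by_contra h; push Not at h; nlinarith
    obtain ⟨e, he, ρ, h3, h4⟩ := key t (by rwa [abs_of_nonpos h2]) (by rwa [abs_of_nonpos h2])
    rw [h4]
    have h5 : 0.0087 * m * 0.7 ≤ ρ * m * (m * -(t - ξ j)) := by gcongr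
    linarith [le_of_abs_le he]

theorem isCluster_nearAccepted (hm : 100 ≤ m)
    (hsep : ∀ j k, j ≠ k → 8 * Real.pi / m ≤ dist (ξ j : Real.Angle) (ξ k : Real.Angle))
    (U W : Submodule ℂ (EuclideanSpace ℂ (Fin m)))
    (hU : U = Submodule.span ℂ (Set.range fun k => steering m (ξ k)))
    (hϑ : sinTheta U W ≤ 0.01) (G : Finset Real.Angle) (j : Fin s) :
    IsCluster G (nearAccepted W G (ξ j)) := by
  have hm' : (100 : ℝ) ≤ m := by exact_mod_cast hm
  have hm0 : (0 : ℝ) < m := by linarith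
  refine ⟨fun u hu => hu.1.1, ?_⟩
  rintro v ⟨hv, hvd⟩ w ⟨hw, hwd⟩ u ⟨huG, hu⟩
  -- A crude localization, enough to lift `u`, `v`, `w` to reals whose differences are below `π`.
  -- There the path condition is betweenness.
  have hud : dist u (ξ j : Real.Angle) ≤ 11.7 / m := by
    have h1 := dist_triangle_left u (ξ j : Real.Angle) v
    have h2 := dist_triangle_right v w (ξ j : Real.Angle)
    have h3 : 11.7 / (m : ℝ) = 3.9 / m + 3.9 / m + 3.9 / m := by ring
    linarith [dist_nonneg (x := u) (y := w)]
  have hlift : ∀ p : Real.Angle, p = ((ξ j + (p - (ξ j : Real.Angle)).toReal : ℝ) : Real.Angle) := by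
    intro p
    rw [Real.Angle.coe_add, Real.Angle.coe_toReal]; abel
  rw [dist_eq_abs_toReal] at hvd hwd hud
  have eu := hlift u
  have ev := hlift v
  have ew := hlift w
  set a := (u - (ξ j : Real.Angle)).toReal
  set b := (v - (ξ j : Real.Angle)).toReal
  set c := (w - (ξ j : Real.Angle)).toReal
  have hsmall : 15.6 / (m : ℝ) ≤ 0.156 := by
    rw [div_le_iff₀ hm0]; linarith
  have h15 : 15.6 / (m : ℝ) = 11.7 / m + 3.9 / m := by ring
  have h117 : 11.7 / (m : ℝ) = 3 * (3.9 / m) := by ring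
  have hpi := Real.pi_gt_three
  have hdist : ∀ p q : ℝ, |p| ≤ 11.7 / m → |q| ≤ 3.9 / m →
      dist ((ξ j + p : ℝ) : Real.Angle) ((ξ j + q : ℝ) : Real.Angle) = |p - q| := by
    intro p q hp hq
    rw [dist_coe_eq, add_sub_add_left_eq_sub]
    rw [add_sub_add_left_eq_sub]
    refine (abs_sub _ _).trans ?_
    linarith
  have h39 : 0 < 3.9 / (m : ℝ) := by positivity
  rw [ev, eu, ew, dist_comm ((ξ j + b : ℝ) : Real.Angle) ((ξ j + a : ℝ) : Real.Angle),
    hdist a b hud hvd.le, hdist a c hud hwd.le, hdist b c (by linarith) hwd.le] at hu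
  have hval : landscape W u < 0.529 ∧ |a| < 3.9 / m := by
    have hbq := hv.2
    have hcq := hw.2
    rw [ev] at hbq
    rw [ew] at hcq
    rw [eu]
    obtain ⟨hmono, hanti⟩ := landscape_monotoneOn hm hsep U W hU hϑ j
    rw [abs_lt] at hvd hwd
    have hbet : (b ≤ a ∧ a ≤ c) ∨ (c ≤ a ∧ a ≤ b) := by
      rcases le_total b c with h | h
      · left
        rw [abs_of_nonpos (sub_nonpos.2 h)] at hu
        constructor <;> linarith [neg_abs_le (a - b), le_abs_self (a - b), neg_abs_le (a - c),
          le_abs_self (a - c)]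
      · right
        rw [abs_of_nonneg (sub_nonneg.2 h)] at hu
        constructor <;> linarith [neg_abs_le (a - b), le_abs_self (a - b), neg_abs_le (a - c),
          le_abs_self (a - c)]
    have ha : |a| < 3.9 / m := by
      rw [abs_lt]
      rcases hbet with h | h <;> constructor <;> linarith
    refine ⟨?_, ha⟩
    rw [abs_lt] at ha
    have hright : ∀ d, a ≤ d → d < 3.9 / m → landscape W ((ξ j + d : ℝ) : Real.Angle) < 0.529 →
        0.7 / m ≤ a → landscape W ((ξ j + a : ℝ) : Real.Angle) < 0.529 := by
      intro d h1 h2 h3 h4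
      refine lt_of_le_of_lt (hmono ?_ ?_ (by linarith : ξ j + a ≤ ξ j + d)) h3 <;>
      constructor <;> linarith
    have hleft : ∀ d, d ≤ a → -(3.9 / m) < d → landscape W ((ξ j + d : ℝ) : Real.Angle) < 0.529 →
        a ≤ -(0.7 / m) → landscape W ((ξ j + a : ℝ) : Real.Angle) < 0.529 := by
      intro d h1 h2 h3 h4
      refine lt_of_le_of_lt (hanti ?_ ?_ (by linarith : ξ j + d ≤ ξ j + a)) h3 <;>
      constructor <;> linarith
    rcases le_total (0.7 / (m : ℝ)) a with h | h
    · rcases hbet with h1 | h1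
      · exact hright c h1.2 hwd.2 hcq h
      · exact hright b h1.2 hvd.2 hbq h
    rcases le_total a (-(0.7 / (m : ℝ))) with h' | h'
    · rcases hbet with h1 | h1
      · exact hleft b h1.1 hvd.1 hbq h'
      · exact hleft c h1.1 hwd.1 hcq h'
    · refine landscape_lt_of_near hm U W hU hϑ j ?_
      rw [add_sub_cancel_left, mul_comm, ← le_div_iff₀ hm0, abs_le]
      exact ⟨h', h⟩
  exact ⟨⟨huG, hval.1⟩, by rw [dist_eq_abs_toReal]; exact hval.2⟩

/-- If a cluster met the neighbourhoods of two nodes, the path between the two points would cross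
the gap beside the first node, which contains a rejected grid point. -/
theorem exists_subset_nearAccepted (hm : 100 ≤ m)
    (hsep : ∀ j k, j ≠ k → 8 * Real.pi / m ≤ dist (ξ j : Real.Angle) (ξ k : Real.Angle))
    (U W : Submodule ℂ (EuclideanSpace ℂ (Fin m)))
    (hU : U = Submodule.span ℂ (Set.range fun k => steering m (ξ k)))
    (hϑ : sinTheta U W ≤ 0.01) {G : Finset Real.Angle}
    (hG : mesh G ≤ ENNReal.ofReal (1 / (2 * (m : ℝ)))) {V : Set Real.Angle} (hne : V.Nonempty)
    (hVA : V ⊆ accepted (landscape W) G 0.529) (hV : IsCluster G V) :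
    ∃ j, V ⊆ nearAccepted W G (ξ j) := by
  have hm' : (100 : ℝ) ≤ m := by exact_mod_cast hm
  have hm0 : (0 : ℝ) < m := by linarith
  have hpi := Real.pi_gt_three
  obtain ⟨v, hvV⟩ := hne
  obtain ⟨j, hvA, hvj⟩ := exists_near_of_accepted hm hsep U W hU hϑ (hVA hvV)
  refine ⟨j, fun w hwV => ?_⟩
  obtain ⟨k, hwA, hwk⟩ := exists_near_of_accepted hm hsep U W hU hϑ (hVA hwV)
  by_cases hjk : j = k
  · rw [hjk]; exact ⟨hwA, hwk⟩
  exfalso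
  set η : ℝ := 1 / m with hη
  have hη0 : 0 < η := by positivity
  have hη1 : η ≤ 0.01 := by
    rw [hη, div_le_iff₀ hm0]; linarith
  have e39 : 3.9 / (m : ℝ) = 3.9 * η := by rw [hη]; ring
  have e12 : 1 / (2 * (m : ℝ)) = 0.5 * η := by rw [hη]; field_simp; norm_num
  have h24 : ∀ l, l ≠ j → 24 * η ≤ dist (ξ l : Real.Angle) (ξ j : Real.Angle) := by
    intro l hl
    refine le_trans ?_ (hsep l j hl)
    rw [hη, mul_one_div]
    gcongr ?_ / _
    linarith
  rw [e39] at hvj hwk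
  have hvw : 16.2 * η ≤ dist w v := by
    have h1 := h24 k (Ne.symm hjk)
    have h2 := dist_triangle4 (ξ k : Real.Angle) w v (ξ j : Real.Angle)
    rw [dist_comm (ξ k : Real.Angle) w] at h2
    linarith
  have hlift : ∀ p : Real.Angle, p = (((v.toReal + (p - v).toReal : ℝ)) : Real.Angle) := by
    intro p
    rw [Real.Angle.coe_add, Real.Angle.coe_toReal, Real.Angle.coe_toReal]; abel
  have hwπ := Real.Angle.abs_toReal_le_pi (w - v)
  have ew := hlift w
  have ej := hlift (ξ j : Real.Angle)
  rw [dist_comm, dist_eq_abs_toReal] at hvj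
  rw [dist_eq_abs_toReal] at hvw
  set a := (w - v).toReal with ha
  set b := ((ξ j : Real.Angle) - v).toReal with hb
  -- `σ` is the direction of the shorter arc from `v` to `w`.
  obtain ⟨σ, hσ, hσa⟩ : ∃ σ : ℝ, |σ| = 1 ∧ |a| = σ * a := by
    rcases le_total 0 a with h | h
    · exact ⟨1, abs_one, by rw [abs_of_nonneg h, one_mul]⟩
    · exact ⟨-1, by rw [abs_neg, abs_one], by rw [abs_of_nonpos h]; ring⟩
  have hσabs : ∀ y : ℝ, |σ * y| = |y| := fun y => by rw [abs_mul, hσ, one_mul]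
  have hσσ : σ * σ = 1 := by rw [← abs_mul_abs_self σ, hσ, one_mul]
  -- The target lies `4.5 / m` beyond `ξ j` towards `w`. With mesh `0.5 / m`, `g` is between `4 / m`
  -- and `5 / m` from `ξ j`, hence rejected; it is past `v`, as `3.9 + 0.5 < 4.5`, and before `w`,
  -- as `9 < 16.2`.
  obtain ⟨g, hgG, hgd⟩ := exists_mesh_dist_le (by positivity) hG
    ((v.toReal + (b + σ * (4.5 * η)) : ℝ) : Real.Angle)
  rw [e12] at hgd
  have hpj : dist ((v.toReal + (b + σ * (4.5 * η)) : ℝ) : Real.Angle) (ξ j : Real.Angle)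
      = 4.5 * η := by
    have e : v.toReal + (b + σ * (4.5 * η)) - (v.toReal + b) = σ * (4.5 * η) := by ring
    rw [ej, dist_coe_eq, e, hσabs, abs_of_pos (by positivity)]
    rw [e, hσabs, abs_of_pos (by positivity)]
    linarith
  have hgA : g ∉ accepted (landscape W) G 0.529 := by
    intro hg
    obtain ⟨l, -, hgl⟩ := exists_near_of_accepted hm hsep U W hU hϑ hg
    rw [e39] at hgl
    have h1 := dist_triangle ((v.toReal + (b + σ * (4.5 * η)) : ℝ) : Real.Angle) g
      (ξ j : Real.Angle)
    have h2 := dist_triangle_left g (ξ j : Real.Angle)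
      ((v.toReal + (b + σ * (4.5 * η)) : ℝ) : Real.Angle)
    by_cases hl : l = j
    · rw [hl] at hgl; linarith
    · have h3 := h24 l hl
      have h4 := dist_triangle_left (ξ l : Real.Angle) (ξ j : Real.Angle) g
      linarith
  have hgv : dist g v ≤ 9 * η := by
    have h2 := dist_triangle_left g (ξ j : Real.Angle)
      ((v.toReal + (b + σ * (4.5 * η)) : ℝ) : Real.Angle)
    have h3 := dist_triangle g (ξ j : Real.Angle) v
    rw [dist_eq_abs_toReal (ξ j : Real.Angle) v] at h3
    linarith
  have eg := hlift g
  rw [dist_eq_abs_toReal] at hgv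
  set c := (g - v).toReal with hc
  have hcb : |b + σ * (4.5 * η) - c| ≤ 0.5 * η := by
    have e : v.toReal + (b + σ * (4.5 * η)) - (v.toReal + c) = b + σ * (4.5 * η) - c := by ring
    rwa [eg, dist_coe_eq, e] at hgd
    rw [e]
    have h1 := abs_sub (b + σ * (4.5 * η)) c
    have h2 := abs_add_le b (σ * (4.5 * η))
    rw [hσabs, abs_of_pos (by positivity : 0 < 4.5 * η)] at h2
    linarith
  have hσc : 0 ≤ σ * c ∧ σ * c ≤ 9 * η := by
    have h1 : |σ * (b + σ * (4.5 * η) - c)| ≤ 0.5 * η := by rwa [hσabs]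
    have h2 : σ * (b + σ * (4.5 * η) - c) = σ * b + 4.5 * η - σ * c := by
      calc _ = σ * b + σ * σ * (4.5 * η) - σ * c := by ring
        _ = _ := by rw [hσσ, one_mul]
    have h3 : |σ * b| < 3.9 * η := by rwa [hσabs]
    rw [h2, abs_le] at h1
    rw [abs_lt] at h3
    constructor <;> linarith [h1.1, h1.2, h3.1, h3.2]
  have hpath : g ∈ path G v w := by
    refine ⟨hgG, ?_⟩
    have hac : |c - a| = |a| - σ * c := by
      rw [← hσabs, mul_sub, ← hσa, abs_of_nonpos (by linarith)]; ring
    have hcc : |c| = σ * c := by rw [← hσabs, abs_of_nonneg hσc.1]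
    have e : v.toReal + c - (v.toReal + a) = c - a := by ring
    rw [dist_comm v g, dist_comm v w, dist_eq_abs_toReal g v, dist_eq_abs_toReal w v, ← hc, ← ha,
      eg, ew, dist_coe_eq, e, hac, hcc]
    · ring
    · rw [e, hac]; linarith [hσc.1]
  exact hgA (hVA (hV.2 v hvV w hwV hpath))

theorem nearAccepted_injective (hm : 100 ≤ m)
    (hsep : ∀ j k, j ≠ k → 8 * Real.pi / m ≤ dist (ξ j : Real.Angle) (ξ k : Real.Angle))
    (U W : Submodule ℂ (EuclideanSpace ℂ (Fin m)))
    (hU : U = Submodule.span ℂ (Set.range fun k => steering m (ξ k)))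
    (hϑ : sinTheta U W ≤ 0.01) {G : Finset Real.Angle}
    (hG : mesh G ≤ ENNReal.ofReal (1 / (2 * (m : ℝ)))) {j k : Fin s}
    (h : nearAccepted W G (ξ j) ⊆ nearAccepted W G (ξ k)) : j = k := by
  have hm' : (100 : ℝ) ≤ m := by exact_mod_cast hm
  have hm0 : (0 : ℝ) < m := by linarith
  obtain ⟨u, hu⟩ := nearAccepted_nonempty hm U W hU hϑ hG j
  by_contra hjk
  have h1 := hsep j k hjk
  have h2 := dist_triangle_left (ξ j : Real.Angle) (ξ k : Real.Angle) u
  have h3 : 3.9 / (m : ℝ) + 3.9 / m ≤ 8 * Real.pi / m := by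
    rw [← add_div]
    gcongr ?_ / _
    linarith [Real.pi_gt_three]
  linarith [hu.2, (h hu).2]

theorem clusters_eq_range (hm : 100 ≤ m)
    (hsep : ∀ j k, j ≠ k → 8 * Real.pi / m ≤ dist (ξ j : Real.Angle) (ξ k : Real.Angle))
    (U W : Submodule ℂ (EuclideanSpace ℂ (Fin m)))
    (hU : U = Submodule.span ℂ (Set.range fun k => steering m (ξ k)))
    (hϑ : sinTheta U W ≤ 0.01) {G : Finset Real.Angle}
    (hG : mesh G ≤ ENNReal.ofReal (1 / (2 * (m : ℝ)))) :
    clusters G (accepted (landscape W) G 0.529)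
      = Set.range fun j => nearAccepted W G (ξ j) := by
  have hP : ∀ j, (nearAccepted W G (ξ j)).Nonempty ∧
      nearAccepted W G (ξ j) ⊆ accepted (landscape W) G 0.529 ∧
      IsCluster G (nearAccepted W G (ξ j)) := fun j =>
    ⟨nearAccepted_nonempty hm U W hU hϑ hG j, fun u hu => hu.1,
      isCluster_nearAccepted hm hsep U W hU hϑ G j⟩
  ext V
  constructor
  · intro hV
    replace hV : Maximal (fun V' : Set Real.Angle => V'.Nonempty ∧
      V' ⊆ accepted (landscape W) G 0.529 ∧ IsCluster G V') V := hV
    obtain ⟨j, hj⟩ := exists_subset_nearAccepted hm hsep U W hU hϑ hG hV.prop.1 hV.prop.2.1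
      hV.prop.2.2
    exact ⟨j, (hV.eq_of_subset (hP j) hj).symm⟩
  · rintro ⟨j, rfl⟩
    refine ⟨hP j, fun V hV hle => ?_⟩
    obtain ⟨k, hk⟩ := exists_subset_nearAccepted hm hsep U W hU hϑ hG hV.1 hV.2.1 hV.2.2
    obtain rfl := nearAccepted_injective hm hsep U W hU hϑ hG (hle.trans hk)
    exact hk

end separated

/-! ### Assembly of the main theorem. -/

theorem le_dist_of_le_minSep {s : ℕ} {x : Fin s → Real.Angle} {δ : ℝ}
    (hx : ENNReal.ofReal δ ≤ minSep x) {j k : Fin s} (hjk : j ≠ k) : δ ≤ dist (x j) (x k) := by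
  have h : minSep x ≤ edist (x j) (x k) :=
    (iInf_le _ j).trans ((iInf_le _ k).trans (iInf_le _ hjk))
  have h2 := hx.trans h
  rwa [edist_dist, ENNReal.ofReal_le_ofReal_iff dist_nonneg] at h2

end GradMUSIC

theorem mainTheorem8 (m s : ℕ) (hm : 100 ≤ m)
    (G : Finset Real.Angle) (hG : mesh G ≤ ENNReal.ofReal (1 / (2 * (m : ℝ))))
    (ε : ℝ) (hε : 0 < ε) (Nmin Nmax : ℕ) (hNmin : 31 ≤ Nmin) (hN : Nmin ≤ Nmax)
    (x : Fin s → Real.Angle)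
    (W : Submodule ℂ (EuclideanSpace ℂ (Fin m))) (hW : Module.finrank ℂ W = s)
    (hx : ENNReal.ofReal (8 * Real.pi / (m : ℝ)) ≤ minSep x)
    (hϑ : subspaceError x W ≤ 0.01) :
    -- the accepted elements have exactly `s` clusters
    (clusters G (accepted (landscape W) G 0.529)).encard = s ∧
    -- from every representative, the termination criterion is met at some iteration
    (∀ V ∈ clusters G (accepted (landscape W) G 0.529), ∀ t₀ ∈ V, ∃ k : ℕ, Nmin ≤ k ∧
      |torusDeriv (landscape W) (gradIter (landscape W) (6 / (m : ℝ) ^ 2) t₀ k)| ≤ ε * m) ∧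
    -- the error bound for every output, indexed to match `x`
    (∀ xhat : Fin s → Real.Angle,
      IsOutput W G 0.529 (6 / (m : ℝ) ^ 2) ε Nmin Nmax xhat →
      ∃ σ : Equiv.Perm (Fin s), ∀ j : Fin s,
        dist (x j) (xhat (σ j)) ≤ 7 * subspaceError x W / m + 37 * ε / m) := by
  have hm0 : m ≠ 0 := by omega
  have hcoe : ∀ j, ((x j).toReal : Real.Angle) = x j := fun j => (x j).coe_toReal
  have hsep : ∀ j k, j ≠ k → 8 * Real.pi / m
      ≤ dist ((x j).toReal : Real.Angle) ((x k).toReal : Real.Angle) := by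
    intro j k hjk
    rw [hcoe, hcoe]
    exact le_dist_of_le_minSep hx hjk
  have hU := fourierSubspace_eq_span hm0 x
  have hcl := clusters_eq_range hm hsep (fourierSubspace m x) W hU hϑ hG
  have hinj : Function.Injective fun j => nearAccepted W G (x j).toReal := fun j k h =>
    nearAccepted_injective hm hsep (fourierSubspace m x) W hU hϑ hG (le_of_eq h)
  refine ⟨?_, fun V _ t₀ _ => exists_gradIter_deriv_le hm0 W t₀ hε Nmin, ?_⟩
  · rw [hcl, ← Set.image_univ, hinj.encard_image, Set.encard_univ]
    simp
  · rintro xhat ⟨V, t₀, n, -, hVrange, ht₀, hn⟩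
    -- The matching sends `j` to the index under which the output enumerates the cluster near `x j`;
    -- distinct nodes have distinct clusters, so it is a permutation.
    have hex : ∀ j, ∃ i, V i = nearAccepted W G (x j).toReal := fun j => by
      have : nearAccepted W G (x j).toReal ∈ Set.range V := by
        rw [hVrange, hcl]; exact ⟨j, rfl⟩
      exact this
    choose σ hσ using hex
    have hσinj : Function.Injective σ := fun j k h => hinj (by
      simp only [← hσ, h])
    refine ⟨Equiv.ofBijective σ (Finite.injective_iff_bijective.1 hσinj), fun j => ?_⟩
    rw [Equiv.ofBijective_apply]
    obtain ⟨hleast, hxhat⟩ := hn (σ j)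
    have hmem := ht₀ (σ j)
    rw [hσ] at hmem
    have h := gradIter_error_le hm hsep (fourierSubspace m x) W hU hϑ j hmem.2.le
      (hNmin.trans hleast.1.1) hε hleast.1.2.2
    rw [hcoe, ← hxhat] at h
    exact h
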